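/- Equip the group $\mathcal H(2^{\mathbb N})$ of homeomorphisms of the Cantor set $2^{\mathbb N}$ with the topology of uniform convergence, and call $\sigma\in\mathcal H(2^{\mathbb N})$ generic if its conjugacy class is comeagre in $\mathcal H(2^{\mathbb N})$. For a homeomorphism $\rho$ of $2^{\mathbb N}$ write $(C(2^{\mathbb N}),\rho)$ for the C*-algebra of continuous functions $2^{\mathbb N}\to\mathbb C$ with the automorphism $f\mapsto f\circ\rho$, viewed as a structure of continuous logic in the language of unital C*-algebras with an additional unary function symbol for an automorphism. Let $\sigma$ be a generic homeomorphism of $2^{\mathbb N}$ and let $T=\operatorname{Th}((C(2^{\mathbb N}),\sigma))$. Then $T$ is not separably categorical: it is not true that any two separable models of $T$ are isomorphic. More precisely, there is a homeomorphism $\tau$ of $2^{\mathbb N}$ such that $(C(2^{\mathbb N}),\tau)$ is a model of $T$ and realizes a type (a set of formulas in finitely many variables) that is omitted in $(C(2^{\mathbb N}),\sigma)$; in particular $\tau$ is not topologically conjugate to $\sigma$. -/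

import Mathlib

noncomputable section

namespace CantorDynamics

/-! ### Homeomorphism groups and generic homeomorphisms -/

/-- The Cantor set `2^ℕ`. -/
abbrev Cantor : Type := ℕ → Bool

/-- The topology of the homeomorphism group of `X`: `f i` converges to `f` when both `f i → f` and
`(f i)⁻¹ → f⁻¹` in the compact-open topology. For compact Hausdorff `X` this is the topology of
uniform convergence (the clause on inverses is then automatic), equivalently the topology of
pointwise convergence of the induced automorphisms of `C(X)`. -/
instance homeoTopology (X : Type*) [TopologicalSpace X] : TopologicalSpace (X ≃ₜ X) :=
  TopologicalSpace.induced
    (fun f : X ≃ₜ X => ((f : C(X, X)), (f.symm : C(X, X)))) inferInstance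

/-- Topological conjugacy of two dynamical systems. -/
def TopConj {X Y : Type*} [TopologicalSpace X] [TopologicalSpace Y]
    (σ : X ≃ₜ X) (τ : Y ≃ₜ Y) : Prop :=
  ∃ h : X ≃ₜ Y, ∀ x, h (σ x) = τ (h x)

/-- A homeomorphism is generic if its conjugacy class is comeagre in the homeomorphism group. -/
def IsGeneric {X : Type*} [TopologicalSpace X] (σ : X ≃ₜ X) : Prop :=
  {τ : X ≃ₜ X | TopConj σ τ} ∈ residual (X ≃ₜ X)

/-- The automorphism `f ↦ f ∘ S` of `C(X)` induced by a homeomorphism `S` of `X`. -/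
def inducedAut {X : Type*} [TopologicalSpace X] (S : X ≃ₜ X) : C(X, ℂ) ≃⋆ₐ[ℂ] C(X, ℂ) :=
  S.compStarAlgEquiv' ℂ ℂ

theorem inducedAut_apply {X : Type*} [TopologicalSpace X] (S : X ≃ₜ X) (f : C(X, ℂ)) (x : X) :
    inducedAut S f x = f (S x) := rfl

/-! ### Continuous logic for unital C⋆-algebras with an automorphism

The language is that of unital C⋆-algebras together with a unary function symbol for an
automorphism. Its structures are the pairs `(A, α)` with `A` a unital C⋆-algebra and `α` a
⋆-automorphism of `A`; the domains of quantification are the closed balls around `0`. -/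

/-- Terms in `n` free variables: `⋆`-polynomials in which the automorphism may be applied. -/
inductive Term (n : ℕ) : Type
  | var : Fin n → Term n
  | one : Term n
  | add : Term n → Term n → Term n
  | mul : Term n → Term n → Term n
  | smul : ℂ → Term n → Term n
  | star : Term n → Term n
  | aut : Term n → Term n

/-- Formulas of continuous logic in `n` free variables: norms of terms, arbitrary continuous
real-valued connectives, and the quantifiers `sup` and `inf` over the closed ball of radius `r`,
which bind the last variable. -/
inductive Formula : ℕ → Type
  | norm {n : ℕ} (t : Term n) : Formula n
  | conn {n k : ℕ} (u : C(Fin k → ℝ, ℝ)) (φ : Fin k → Formula n) : Formula n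
  | sup {n : ℕ} (r : ℕ) (φ : Formula (n + 1)) : Formula n
  | inf {n : ℕ} (r : ℕ) (φ : Formula (n + 1)) : Formula n

/-- A sentence is a formula without free variables. -/
abbrev Sentence : Type := Formula 0

section Semantics

variable {A : Type*} [CStarAlgebra A] (α : A ≃⋆ₐ[ℂ] A)

/-- The interpretation of a term in `(A, α)`. -/
def Term.eval {n : ℕ} (v : Fin n → A) : Term n → A
  | .var i => v i
  | .one => 1
  | .add s t => s.eval v + t.eval v
  | .mul s t => s.eval v * t.eval v
  | .smul c t => c • t.eval v
  | .star t => Star.star (t.eval v)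
  | .aut t => α (t.eval v)

/-- The value of a formula in `(A, α)`. -/
def Formula.eval : {n : ℕ} → Formula n → (Fin n → A) → ℝ
  | _, .norm t, v => ‖t.eval α v‖
  | _, .conn u φ, v => u fun i => (φ i).eval v
  | _, .sup r φ, v => ⨆ x : Metric.closedBall (0 : A) r, φ.eval (Fin.snoc v (x : A))
  | _, .inf r φ, v => ⨅ x : Metric.closedBall (0 : A) r, φ.eval (Fin.snoc v (x : A))

/-- Terms are bounded on bounded sets. -/
theorem Term.exists_bound {n : ℕ} (t : Term n) (R : ℝ) :
    ∃ C : ℝ, ∀ v : Fin n → A, (∀ i, ‖v i‖ ≤ R) → ‖t.eval α v‖ ≤ C := by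
  induction t with
  | var i => exact ⟨R, fun v hv => hv i⟩
  | one => exact ⟨‖(1 : A)‖, fun v _ => le_rfl⟩
  | add s t hs ht =>
    obtain ⟨C, hC⟩ := hs
    obtain ⟨D, hD⟩ := ht
    exact ⟨C + D, fun v hv => (norm_add_le _ _).trans (add_le_add (hC v hv) (hD v hv))⟩
  | mul s t hs ht =>
    obtain ⟨C, hC⟩ := hs
    obtain ⟨D, hD⟩ := ht
    refine ⟨C * D, fun v hv => (norm_mul_le _ _).trans ?_⟩
    exact mul_le_mul (hC v hv) (hD v hv) (norm_nonneg _) ((norm_nonneg _).trans (hC v hv))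
  | smul c t ht =>
    obtain ⟨C, hC⟩ := ht
    refine ⟨‖c‖ * C, fun v hv => ?_⟩
    simp only [Term.eval, norm_smul]
    exact mul_le_mul_of_nonneg_left (hC v hv) (norm_nonneg _)
  | star t ht =>
    obtain ⟨C, hC⟩ := ht
    refine ⟨C, fun v hv => ?_⟩
    simp only [Term.eval, norm_star]
    exact hC v hv
  | aut t ht =>
    obtain ⟨C, hC⟩ := ht
    refine ⟨C, fun v hv => ?_⟩
    simp only [Term.eval]
    rw [NonUnitalStarAlgHom.norm_map α α.injective]
    exact hC v hv

/-- Formulas are bounded on bounded sets, so the suprema and infima in `Formula.eval` are taken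
over bounded non-empty sets of reals. -/
theorem Formula.exists_bound {n : ℕ} (φ : Formula n) (R : ℝ) :
    ∃ C : ℝ, ∀ v : Fin n → A, (∀ i, ‖v i‖ ≤ R) → |φ.eval α v| ≤ C := by
  have key : ∀ {n : ℕ} (r : ℕ) (R : ℝ) (v : Fin n → A) (x : Metric.closedBall (0 : A) r),
      (∀ i, ‖v i‖ ≤ R) → ∀ i, ‖(Fin.snoc v (x : A) : Fin (n + 1) → A) i‖ ≤ max R r := by
    intro n r R v x hv i
    refine Fin.lastCases ?_ (fun j => ?_) i
    · simpa using Or.inr (mem_closedBall_zero_iff.1 x.2)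
    · simpa using Or.inl (hv j)
  induction φ generalizing R with
  | norm t =>
    obtain ⟨C, hC⟩ := t.exists_bound α R
    exact ⟨C, fun v hv => by simpa [Formula.eval] using hC v hv⟩
  | conn u φ ih =>
    choose C hC using fun i => ih i R
    obtain ⟨D, hD⟩ := (isCompact_univ_pi fun i =>
      (isCompact_Icc : IsCompact (Set.Icc (-C i) (C i)))).exists_bound_of_continuousOn
        u.continuous.continuousOn
    exact ⟨D, fun v hv => hD _ fun i _ => abs_le.1 (hC i v hv)⟩
  | sup r φ ih =>
    obtain ⟨C, hC⟩ := ih (max R r)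
    refine ⟨C, fun v hv => ?_⟩
    have h := fun x => abs_le.1 (hC _ (key r R v x hv))
    have x₀ : Metric.closedBall (0 : A) (r : ℝ) := ⟨0, by simp⟩
    have : Nonempty (Metric.closedBall (0 : A) (r : ℝ)) := ⟨x₀⟩
    refine abs_le.2 ⟨(h x₀).1.trans ?_, ciSup_le fun x => (h x).2⟩
    exact le_ciSup (f := fun x : Metric.closedBall (0 : A) (r : ℝ) =>
      φ.eval α (Fin.snoc v (x : A))) ⟨C, by rintro _ ⟨x, rfl⟩; exact (h x).2⟩ x₀
  | inf r φ ih =>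
    obtain ⟨C, hC⟩ := ih (max R r)
    refine ⟨C, fun v hv => ?_⟩
    have h := fun x => abs_le.1 (hC _ (key r R v x hv))
    have x₀ : Metric.closedBall (0 : A) (r : ℝ) := ⟨0, by simp⟩
    have : Nonempty (Metric.closedBall (0 : A) (r : ℝ)) := ⟨x₀⟩
    refine abs_le.2 ⟨le_ciInf fun x => (h x).1, le_trans ?_ (h x₀).2⟩
    exact ciInf_le (f := fun x : Metric.closedBall (0 : A) (r : ℝ) =>
      φ.eval α (Fin.snoc v (x : A))) ⟨-C, by rintro _ ⟨x, rfl⟩; exact (h x).1⟩ x₀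

/-- `(A, α)` is a model of the set `T` of sentences if every sentence of `T` has value `0`. -/
def Models (T : Set Sentence) : Prop :=
  ∀ φ ∈ T, φ.eval α Fin.elim0 = 0

/-- The theory of `(A, α)`: all sentences with value `0`. Since `φ - r` is a sentence for every
sentence `φ` and real `r`, the theory determines the values of all sentences. -/
def theory : Set Sentence :=
  {φ | φ.eval α Fin.elim0 = 0}

/-- A tuple of `A` realizes the set `p` of formulas (a type in `n` variables) if every formula of
`p` has value `0` at it; `(A, α)` realizes `p` if one of its `n`-tuples does. -/
def Realizes {n : ℕ} (p : Set (Formula n)) : Prop :=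
  ∃ a : Fin n → A, ∀ φ ∈ p, φ.eval α a = 0

end Semantics

/-- Isomorphism of C⋆-algebras with an automorphism. -/
def Isomorphic {A B : Type*} [CStarAlgebra A] [CStarAlgebra B]
    (α : A ≃⋆ₐ[ℂ] A) (β : B ≃⋆ₐ[ℂ] B) : Prop :=
  ∃ Φ : A ≃⋆ₐ[ℂ] B, ∀ a, Φ (α a) = β (Φ a)

/-- A theory is separably categorical if any two separable models are isomorphic. (A separable
C⋆-algebra has at most continuum many elements, so up to isomorphism all separable models live in
the lowest universe.) -/
def SeparablyCategorical (T : Set Sentence) : Prop :=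
  ∀ (A B : Type) [CStarAlgebra A] [CStarAlgebra B]
    [TopologicalSpace.SeparableSpace A] [TopologicalSpace.SeparableSpace B]
    (α : A ≃⋆ₐ[ℂ] A) (β : B ≃⋆ₐ[ℂ] B),
    Models α T → Models β T → Isomorphic α β

end CantorDynamics

end

noncomputable section

namespace CantorDynamics

open Set Filter Topology

/-! ### Back-and-forth types of labellings -/

/-! To a clopen set `a` attach its return times: the `k` such that `a` meets its preimage under the
iterate of order `k + 1`. The Cantor set has only countably many clopen sets, so by diagonalization
some `A : Set ℕ` is not the set of return times of any clopen set under `σ`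
(`exists_not_returnTimes`). No finite part of `A` is an obstruction: admitting a clopen set whose
return times agree with `A` below `m` is an open condition on homeomorphisms, the full shift
satisfies it, and a comeagre conjugacy class meets every nonempty open set
(`IsGeneric.exists_returnTimes`). Hence the type of an idempotent with return times `A` is omitted
by `σ` (`realizes_returnType_iff`), although every finite part of it is realized.

A system `τ` realizing it comes from a Löwenheim–Skolem argument inside an ultrapower, carried out
on clopen sets. The sequence of clopen sets that agree with `A` further and further is closed up to
a countable family under Boolean operations, composition with `σ` and its inverse, and Skolem
witnesses. Along a nonprincipal ultrafilter the family has a limit algebra, countable and atomless,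
whose Stone space is again the Cantor set (`exists_homeo_pattern_eq_returnTimes`,
`nonempty_homeomorph_cantor`).

Elementary equivalence is handled by Ehrenfeucht–Fraïssé types of labellings, `pattern S m d P`. For
a finite label set they take finitely many values, which gives a Łoś theorem
(`eventually_pattern_eq`). They control continuous logic because an element of a ball of `C(X)` is
uniformly close to a step function with values in a finite net, that is, to finitely many clopen
sets; so each formula is determined up to `ε` by some type of finite depth
(`Formula.exists_pattern_abs_sub_le`). -/

/-- Hereditarily finite codes for the types, with `d` quantifiers over clopen sets and looking at
words of length `m`, of maps into `W`. -/
def Pattern (m : ℕ) : ℕ → Type → Type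
  | 0, W => Set (Fin m → W)
  | d + 1, W => Set (Pattern m d (W × Bool))

instance Pattern.finite (m d : ℕ) (W : Type) [Finite W] : Finite (Pattern m d W) := by
  induction d generalizing W with
  | zero => exact inferInstanceAs (Finite (Set (Fin m → W)))
  | succ d ih =>
    have := ih (W × Bool)
    exact inferInstanceAs (Finite (Set (Pattern m d (W × Bool))))

section Pattern

variable {X Y : Type*} [TopologicalSpace X] [TopologicalSpace Y]

/-- The type of a labelling `P` of the dynamical system `(X, S)`. -/
def pattern (S : X ≃ₜ X) (m : ℕ) : (d : ℕ) → {W : Type} → (X → W) → Pattern m d W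
  | 0, W, P => ({w | ∃ x, ∀ i : Fin m, P (S^[i] x) = w i} : Set (Fin m → W))
  | d + 1, W, P => ({t | ∃ Q : C(X, Bool), pattern S m d (fun x => (P x, Q x)) = t} :
      Set (Pattern m d (W × Bool)))

variable {S : X ≃ₜ X} {T : Y ≃ₜ Y} {m d : ℕ} {W V : Type}

theorem pattern_zero_eq_iff {P : X → W} {P' : Y → W} :
    pattern S m 0 P = pattern T m 0 P' ↔
      (∀ x, ∃ y, ∀ i : Fin m, P (S^[i] x) = P' (T^[i] y)) ∧
      (∀ y, ∃ x, ∀ i : Fin m, P (S^[i] x) = P' (T^[i] y)) := by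
  simp only [pattern]
  constructor
  · intro h
    constructor
    · intro x
      have : (fun i : Fin m => P (S^[i] x)) ∈
          {w : Fin m → W | ∃ x, ∀ i : Fin m, P (S^[i] x) = w i} := ⟨x, fun _ => rfl⟩
      rw [h] at this
      obtain ⟨y, hy⟩ := this
      exact ⟨y, fun i => (hy i).symm⟩
    · intro y
      have : (fun i : Fin m => P' (T^[i] y)) ∈
          {w : Fin m → W | ∃ x, ∀ i : Fin m, P' (T^[i] x) = w i} := ⟨y, fun _ => rfl⟩
      rw [← h] at this
      exact this
  · rintro ⟨h₁, h₂⟩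
    refine Set.ext fun w => ⟨?_, ?_⟩
    · rintro ⟨x, hx⟩
      obtain ⟨y, hy⟩ := h₁ x
      exact ⟨y, fun i => (hy i).symm.trans (hx i)⟩
    · rintro ⟨y, hy⟩
      obtain ⟨x, hx⟩ := h₂ y
      exact ⟨x, fun i => (hx i).trans (hy i)⟩

theorem pattern_succ_eq_iff {P : X → W} {P' : Y → W} :
    pattern S m (d + 1) P = pattern T m (d + 1) P' ↔
      (∀ Q : C(X, Bool), ∃ Q' : C(Y, Bool),
        pattern S m d (fun x => (P x, Q x)) = pattern T m d (fun x => (P' x, Q' x))) ∧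
      (∀ Q' : C(Y, Bool), ∃ Q : C(X, Bool),
        pattern S m d (fun x => (P x, Q x)) = pattern T m d (fun x => (P' x, Q' x))) := by
  simp only [pattern]
  constructor
  · intro h
    constructor
    · intro Q
      have : pattern S m d (fun x => (P x, Q x)) ∈
          {t | ∃ Q : C(X, Bool), pattern S m d (fun x => (P x, Q x)) = t} := ⟨Q, rfl⟩
      rw [h] at this
      obtain ⟨Q', hQ⟩ := this
      exact ⟨Q', hQ.symm⟩
    · intro Q'
      have : pattern T m d (fun x => (P' x, Q' x)) ∈
          {t | ∃ Q : C(Y, Bool), pattern T m d (fun x => (P' x, Q x)) = t} := ⟨Q', rfl⟩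
      rw [← h] at this
      exact this
  · rintro ⟨h₁, h₂⟩
    refine Set.ext fun t => ⟨?_, ?_⟩
    · rintro ⟨Q, rfl⟩
      obtain ⟨Q', h⟩ := h₁ Q
      exact ⟨Q', h.symm⟩
    · rintro ⟨Q', rfl⟩
      exact h₂ Q'

/-- Relabelling commutes with all later choices of clopen sets, so the same answers keep working.
Since `f` may forget information, this also serves to drop and rearrange coordinates. -/
theorem pattern_comp {P : X → W} {P' : Y → W} (h : pattern S m d P = pattern T m d P')
    (f : W → V) :
    pattern S m d (fun x => f (P x)) = pattern T m d (fun x => f (P' x)) := by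
  induction d generalizing W V with
  | zero =>
    rw [pattern_zero_eq_iff] at h ⊢
    refine ⟨fun x => ?_, fun y => ?_⟩
    · obtain ⟨y, hy⟩ := h.1 x
      exact ⟨y, fun i => congrArg f (hy i)⟩
    · obtain ⟨x, hx⟩ := h.2 y
      exact ⟨x, fun i => congrArg f (hx i)⟩
  | succ d ih =>
    rw [pattern_succ_eq_iff] at h ⊢
    refine ⟨fun Q => ?_, fun Q' => ?_⟩
    · obtain ⟨Q', hQ⟩ := h.1 Q
      exact ⟨Q', ih hQ (Prod.map f id)⟩
    · obtain ⟨Q, hQ⟩ := h.2 Q'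
      exact ⟨Q, ih hQ (Prod.map f id)⟩

theorem pattern_mono {m' d' : ℕ} {P : X → W} {P' : Y → W} (hm : m' ≤ m) (hd : d' ≤ d)
    (h : pattern S m d P = pattern T m d P') : pattern S m' d' P = pattern T m' d' P' := by
  have hdrop : pattern S m d' P = pattern T m d' P' := by
    induction d, hd using Nat.le_induction with
    | base => exact h
    | succ d _ ih =>
      -- A wasted move: a constant set is played, and its answer, whatever it is, is forgotten.
      obtain ⟨Q', hQ⟩ := (pattern_succ_eq_iff.1 h).1 (ContinuousMap.const X false)
      exact ih (pattern_comp hQ Prod.fst)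
  clear h hd
  induction d' generalizing W with
  | zero =>
    rw [pattern_zero_eq_iff] at hdrop ⊢
    refine ⟨fun x => ?_, fun y => ?_⟩
    · obtain ⟨y, hy⟩ := hdrop.1 x
      exact ⟨y, fun i => hy (Fin.castLE hm i)⟩
    · obtain ⟨x, hx⟩ := hdrop.2 y
      exact ⟨x, fun i => hx (Fin.castLE hm i)⟩
  | succ d' ih =>
    rw [pattern_succ_eq_iff] at hdrop ⊢
    refine ⟨fun Q => ?_, fun Q' => ?_⟩
    · obtain ⟨Q', hQ⟩ := hdrop.1 Q
      exact ⟨Q', ih hQ⟩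
    · obtain ⟨Q, hQ⟩ := hdrop.2 Q'
      exact ⟨Q, ih hQ⟩

/-- A map into `Fin l → Bool` amounts to `l` clopen sets played one after the other, which costs `l`
units of depth. -/
theorem exists_pattern_extension {P : X → W} {P' : Y → W} (l : ℕ)
    (h : pattern S m (d + l) P = pattern T m (d + l) P') (Q : C(X, Fin l → Bool)) :
    ∃ Q' : C(Y, Fin l → Bool),
      pattern S m d (fun x => (P x, Q x)) = pattern T m d (fun x => (P' x, Q' x)) := by
  induction l generalizing W with
  | zero =>
    refine ⟨ContinuousMap.const Y Fin.elim0, ?_⟩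
    have := pattern_comp (d := d) h (fun w => (w, (Fin.elim0 : Fin 0 → Bool)))
    have hQ : ∀ x, Q x = Fin.elim0 := fun x => Subsingleton.elim _ _
    simpa only [hQ, ContinuousMap.const_apply] using this
  | succ l ih =>
    obtain ⟨q, hq⟩ := ((pattern_succ_eq_iff (d := d + l)).1 h).1
      ⟨fun x => Q x (Fin.last l), by fun_prop⟩
    obtain ⟨Q', hQ⟩ := ih hq ⟨fun x i => Q x i.castSucc, by fun_prop⟩
    refine ⟨⟨fun y => Fin.snoc (Q' y) (q y), ?_⟩, ?_⟩
    · exact Q'.continuous.finSnoc q.continuous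
    · have := pattern_comp hQ (fun w => (w.1.1, (Fin.snoc w.2 w.1.2 : Fin (l + 1) → Bool)))
      convert this using 4 with x
      · ext i
        refine Fin.lastCases ?_ (fun j => ?_) i <;> simp
      · rfl

theorem pattern_conj (g : X ≃ₜ Y) (hg : ∀ x, g (S x) = T (g x)) (P : Y → W) :
    pattern S m d (fun x => P (g x)) = pattern T m d P := by
  have hit : ∀ (i : ℕ) x, g (S^[i] x) = T^[i] (g x) := fun i x =>
    Function.Semiconj.iterate_right (f := g) hg i x
  induction d generalizing W with
  | zero =>
    rw [pattern_zero_eq_iff]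
    refine ⟨fun x => ⟨g x, fun i => by rw [hit]⟩, fun y => ⟨g.symm y, fun i => by
      rw [hit, g.apply_symm_apply]⟩⟩
  | succ d ih =>
    rw [pattern_succ_eq_iff]
    refine ⟨fun Q => ⟨Q.comp (g.symm : C(Y, X)), ?_⟩, fun Q' => ⟨Q'.comp (g : C(X, Y)), ?_⟩⟩
    · have := ih (fun y => (P y, Q (g.symm y)))
      simpa using this
    · exact ih (fun y => (P y, Q' y))

end Pattern

/-! ### Uniform continuity of formulas -/

section UniformContinuity

variable {A : Type*} [CStarAlgebra A] (α : A ≃⋆ₐ[ℂ] A)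

/-- The modulus may depend on the structure: only two systems are ever compared, and the smaller of
their two moduli is then used. -/
theorem Term.exists_delta {n : ℕ} (t : Term n) (R : ℝ) {ε : ℝ} (hε : 0 < ε) :
    ∃ δ > 0, ∀ v w : Fin n → A, (∀ i, ‖v i‖ ≤ R) → (∀ i, ‖w i‖ ≤ R) → (∀ i, ‖v i - w i‖ ≤ δ) →
      ‖t.eval α v - t.eval α w‖ ≤ ε := by
  induction t generalizing ε with
  | var i => exact ⟨ε, hε, fun v w _ _ h => h i⟩
  | one => exact ⟨1, one_pos, fun v w _ _ _ => by simpa [Term.eval] using hε.le⟩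
  | add s t hs ht =>
    obtain ⟨δ₁, h₁, hs⟩ := hs (half_pos hε)
    obtain ⟨δ₂, h₂, ht⟩ := ht (half_pos hε)
    refine ⟨min δ₁ δ₂, lt_min h₁ h₂, fun v w hv hw h => ?_⟩
    have a := hs v w hv hw fun i => (h i).trans (min_le_left _ _)
    have b := ht v w hv hw fun i => (h i).trans (min_le_right _ _)
    simp only [Term.eval]
    rw [add_sub_add_comm]
    linarith [norm_add_le (s.eval α v - s.eval α w) (t.eval α v - t.eval α w)]
  | mul s t hs ht =>
    obtain ⟨C, hC⟩ := s.exists_bound α R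
    obtain ⟨D, hD⟩ := t.exists_bound α R
    set K := max (max C D) 1
    have hK : 0 < K := lt_of_lt_of_le one_pos (le_max_right _ _)
    obtain ⟨δ₁, h₁, hs⟩ := hs (ε := ε / (2 * K)) (by positivity)
    obtain ⟨δ₂, h₂, ht⟩ := ht (ε := ε / (2 * K)) (by positivity)
    refine ⟨min δ₁ δ₂, lt_min h₁ h₂, fun v w hv hw h => ?_⟩
    have a := hs v w hv hw fun i => (h i).trans (min_le_left _ _)
    have b := ht v w hv hw fun i => (h i).trans (min_le_right _ _)
    have c : ‖s.eval α v‖ ≤ K := (hC v hv).trans ((le_max_left _ _).trans (le_max_left _ _))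
    have e : ‖t.eval α w‖ ≤ K := (hD w hw).trans ((le_max_right _ _).trans (le_max_left _ _))
    simp only [Term.eval]
    have : s.eval α v * t.eval α v - s.eval α w * t.eval α w =
      s.eval α v * (t.eval α v - t.eval α w) + (s.eval α v - s.eval α w) * t.eval α w := by
      noncomm_ring
    rw [this]
    calc _ ≤ ‖s.eval α v‖ * ‖t.eval α v - t.eval α w‖ +
          ‖s.eval α v - s.eval α w‖ * ‖t.eval α w‖ :=
          (norm_add_le _ _).trans (add_le_add (norm_mul_le _ _) (norm_mul_le _ _))
      _ ≤ K * (ε / (2 * K)) + ε / (2 * K) * K := by gcongr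
      _ = ε := by field_simp; ring
  | smul c t ht =>
    obtain ⟨δ, h, ht⟩ := ht (ε := ε / (‖c‖ + 1)) (by positivity)
    refine ⟨δ, h, fun v w hv hw h => ?_⟩
    simp only [Term.eval]
    rw [← smul_sub, norm_smul]
    calc _ ≤ (‖c‖ + 1) * (ε / (‖c‖ + 1)) := by
          gcongr
          · linarith
          · exact ht v w hv hw h
      _ = ε := by field_simp
  | star t ht =>
    obtain ⟨δ, h, ht⟩ := ht hε
    refine ⟨δ, h, fun v w hv hw h => ?_⟩
    simp only [Term.eval]
    rw [← star_sub, norm_star]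
    exact ht v w hv hw h
  | aut t ht =>
    obtain ⟨δ, h, ht⟩ := ht hε
    refine ⟨δ, h, fun v w hv hw h => ?_⟩
    simp only [Term.eval]
    rw [← map_sub, NonUnitalStarAlgHom.norm_map α α.injective]
    exact ht v w hv hw h

theorem norm_snoc_le {n : ℕ} {r : ℕ} {R : ℝ} {v : Fin n → A} {x : A} (hv : ∀ i, ‖v i‖ ≤ R)
    (hx : ‖x‖ ≤ r) (i : Fin (n + 1)) : ‖(Fin.snoc v x : Fin (n + 1) → A) i‖ ≤ max R r := by
  refine Fin.lastCases ?_ (fun j => ?_) i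
  · simpa using Or.inr hx
  · simpa using Or.inl (hv j)

theorem Formula.abs_eval_snoc_le {n : ℕ} (φ : Formula (n + 1)) (R : ℝ) (r : ℕ) :
    ∃ C : ℝ, ∀ v : Fin n → A, (∀ i, ‖v i‖ ≤ R) → ∀ x : Metric.closedBall (0 : A) r,
      |φ.eval α (Fin.snoc v (x : A))| ≤ C := by
  obtain ⟨C, hC⟩ := φ.exists_bound α (max R r)
  exact ⟨C, fun v hv x => hC _ (norm_snoc_le hv (mem_closedBall_zero_iff.1 x.2))⟩

instance closedBall_nonempty (r : ℕ) : Nonempty (Metric.closedBall (0 : A) (r : ℝ)) :=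
  ⟨⟨0, by simp⟩⟩

end UniformContinuity

/-! ### Comparison of suprema and infima, and finite choices of constants -/

theorem ciSup_le_ciSup_add {ι κ : Type*} [Nonempty ι] {f : ι → ℝ} {g : κ → ℝ} {C ε : ℝ}
    (hg : ∀ j, |g j| ≤ C) (h : ∀ i, ∃ j, |f i - g j| ≤ ε) : ⨆ i, f i ≤ (⨆ j, g j) + ε := by
  refine ciSup_le fun i => ?_
  obtain ⟨j, hj⟩ := h i
  have : g j ≤ ⨆ j, g j := le_ciSup ⟨C, by rintro _ ⟨j, rfl⟩; exact (abs_le.1 (hg j)).2⟩ j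
  linarith [(abs_le.1 hj).2]

theorem abs_ciSup_sub_ciSup_le {ι κ : Type*} [Nonempty ι] [Nonempty κ] {f : ι → ℝ} {g : κ → ℝ}
    {C D ε : ℝ} (hf : ∀ i, |f i| ≤ C) (hg : ∀ j, |g j| ≤ D) (h : ∀ i, ∃ j, |f i - g j| ≤ ε)
    (h' : ∀ j, ∃ i, |f i - g j| ≤ ε) : |(⨆ i, f i) - ⨆ j, g j| ≤ ε := by
  have h₁ := ciSup_le_ciSup_add hg h
  have h₂ := ciSup_le_ciSup_add (f := g) (g := f) (ε := ε) hf fun j =>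
    (h' j).imp fun i hi => by rwa [abs_sub_comm]
  rw [abs_le]
  constructor <;> linarith

/-- No boundedness is needed, because the infimum of a set of reals is defined through the supremum
of its negation. Estimates for suprema thus carry over to infima. -/
theorem ciInf_eq_neg_ciSup_neg {ι : Type*} (f : ι → ℝ) : ⨅ i, f i = -⨆ i, -f i := by
  rw [iInf, Real.sInf_def, ← Set.image_neg_eq_neg, ← Set.range_comp]
  rfl

theorem abs_ciInf_sub_ciInf_le {ι κ : Type*} [Nonempty ι] [Nonempty κ] {f : ι → ℝ} {g : κ → ℝ}
    {C D ε : ℝ} (hf : ∀ i, |f i| ≤ C) (hg : ∀ j, |g j| ≤ D) (h : ∀ i, ∃ j, |f i - g j| ≤ ε)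
    (h' : ∀ j, ∃ i, |f i - g j| ≤ ε) : |(⨅ i, f i) - ⨅ j, g j| ≤ ε := by
  have e : ∀ x y : ℝ, |-x - -y| = |x - y| := fun x y => by
    rw [abs_sub_comm]; congr 1; ring
  have := abs_ciSup_sub_ciSup_le (f := fun i => -f i) (g := fun j => -g j) (C := C) (D := D)
    (ε := ε) (by simpa using hf) (by simpa using hg) (by simpa only [e] using h)
    (by simpa only [e] using h')
  rw [ciInf_eq_neg_ciSup_neg, ciInf_eq_neg_ciSup_neg g, e]
  exact this

theorem exists_delta_of_continuous {k : ℕ} (u : C(Fin k → ℝ, ℝ)) (C : ℝ) {ε : ℝ} (hε : 0 < ε) :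
    ∃ δ > 0, ∀ a b : Fin k → ℝ, (∀ i, |a i| ≤ C) → (∀ i, |b i| ≤ C) → (∀ i, |a i - b i| ≤ δ) →
      |u a - u b| ≤ ε := by
  have hc : IsCompact (Set.univ.pi fun _ : Fin k => Set.Icc (-C) C) :=
    isCompact_univ_pi fun _ => isCompact_Icc
  have hu := hc.uniformContinuousOn_of_continuous u.continuous.continuousOn
  obtain ⟨δ, hδ, h⟩ := Metric.uniformContinuousOn_iff_le.1 hu ε hε
  refine ⟨δ, hδ, fun a b ha hb hab => ?_⟩
  have := h a (fun i _ => abs_le.1 (ha i)) b (fun i _ => abs_le.1 (hb i))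
    ((dist_pi_le_iff hδ.le).2 fun i => by simpa [Real.dist_eq] using hab i)
  simpa [Real.dist_eq] using this

theorem exists_delta_forall {ι : Type*} [Finite ι] {p : ι → ℝ → Prop}
    (hp : ∀ i, ∃ δ > 0, p i δ) (hmono : ∀ i δ δ', δ' ≤ δ → p i δ → p i δ') :
    ∃ δ > 0, ∀ i, p i δ := by
  choose δ hδ h using hp
  rcases isEmpty_or_nonempty ι with hι | hι
  · exact ⟨1, one_pos, fun i => hι.elim i⟩
  · obtain ⟨i₀, hi₀⟩ := Finite.exists_min δ
    exact ⟨δ i₀, hδ i₀, fun i => hmono i _ _ (hi₀ i) (h i)⟩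

theorem exists_upper_bound {ι : Type*} [Finite ι] (f : ι → ℝ) : ∃ C, ∀ i, f i ≤ C := by
  obtain ⟨C, hC⟩ := (Set.finite_range f).bddAbove
  exact ⟨C, fun i => hC ⟨i, rfl⟩⟩

section UniformContinuity

variable {A : Type*} [CStarAlgebra A] (α : A ≃⋆ₐ[ℂ] A)

theorem Formula.exists_delta {n : ℕ} (φ : Formula n) (R : ℝ) {ε : ℝ} (hε : 0 < ε) :
    ∃ δ > 0, ∀ v w : Fin n → A, (∀ i, ‖v i‖ ≤ R) → (∀ i, ‖w i‖ ≤ R) → (∀ i, ‖v i - w i‖ ≤ δ) →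
      |φ.eval α v - φ.eval α w| ≤ ε := by
  have key : ∀ {n r : ℕ} {φ : Formula (n + 1)} {R δ ε : ℝ}, 0 < δ →
      (∀ v w : Fin (n + 1) → A, (∀ i, ‖v i‖ ≤ max R r) → (∀ i, ‖w i‖ ≤ max R r) →
        (∀ i, ‖v i - w i‖ ≤ δ) → |φ.eval α v - φ.eval α w| ≤ ε) →
      ∀ v w : Fin n → A, (∀ i, ‖v i‖ ≤ R) → (∀ i, ‖w i‖ ≤ R) → (∀ i, ‖v i - w i‖ ≤ δ) →
      ∀ x : Metric.closedBall (0 : A) (r : ℝ),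
        |φ.eval α (Fin.snoc v (x : A)) - φ.eval α (Fin.snoc w (x : A))| ≤ ε := by
    intro n r φ R δ ε hδ h v w hv hw hvw x
    have hx := mem_closedBall_zero_iff.1 x.2
    refine h _ _ (norm_snoc_le hv hx) (norm_snoc_le hw hx) fun i => ?_
    refine Fin.lastCases ?_ (fun j => ?_) i
    · simpa using hδ.le
    · simpa using hvw j
  induction φ generalizing R ε with
  | norm t =>
    obtain ⟨δ, hδ, h⟩ := t.exists_delta α R hε
    exact ⟨δ, hδ, fun v w hv hw hvw => (abs_norm_sub_norm_le _ _).trans (h v w hv hw hvw)⟩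
  | conn u φ ih =>
    choose B hB using fun i => (φ i).exists_bound α R
    obtain ⟨C, hC⟩ := exists_upper_bound B
    obtain ⟨η, hη, hu⟩ := exists_delta_of_continuous u C hε
    obtain ⟨δ, hδ, h⟩ := exists_delta_forall (fun i => ih i R hη)
      (fun i δ δ' hle h v w hv hw hvw => h v w hv hw fun i => (hvw i).trans hle)
    exact ⟨δ, hδ, fun v w hv hw hvw => hu _ _ (fun i => (hB i v hv).trans (hC i))
      (fun i => (hB i w hw).trans (hC i)) fun i => h i v w hv hw hvw⟩
  | sup r φ ih =>
    obtain ⟨δ, hδ, h⟩ := ih (max R r) hε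
    obtain ⟨C, hC⟩ := φ.abs_eval_snoc_le α R r
    refine ⟨δ, hδ, fun v w hv hw hvw => ?_⟩
    have := key hδ h v w hv hw hvw
    exact abs_ciSup_sub_ciSup_le (hC v hv) (hC w hw) (fun x => ⟨x, this x⟩) fun x => ⟨x, this x⟩
  | inf r φ ih =>
    obtain ⟨δ, hδ, h⟩ := ih (max R r) hε
    obtain ⟨C, hC⟩ := φ.abs_eval_snoc_le α R r
    refine ⟨δ, hδ, fun v w hv hw hvw => ?_⟩
    have := key hδ h v w hv hw hvw
    exact abs_ciInf_sub_ciInf_le (hC v hv) (hC w hw) (fun x => ⟨x, this x⟩) fun x => ⟨x, this x⟩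

end UniformContinuity

/-! ### Evaluation of formulas is controlled by types of labellings -/

/-- The value of a term on a sequence of labels, when the variables are functions of the labels. -/
def Term.labelEval {n : ℕ} {W : Type} (c : Fin n → W → ℂ) : Term n → (ℕ → W) → ℂ
  | .var i, w => c i (w 0)
  | .one, _ => 1
  | .add s t, w => s.labelEval c w + t.labelEval c w
  | .mul s t, w => s.labelEval c w * t.labelEval c w
  | .smul a t, w => a * t.labelEval c w
  | .star t, w => Star.star (t.labelEval c w)
  | .aut t, w => t.labelEval c fun k => w (k + 1)

/-- Each application of the automorphism looks one letter further along the orbit, and a term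
contains finitely many. -/
theorem Term.exists_labelEval_congr {n : ℕ} {W : Type} (c : Fin n → W → ℂ) (t : Term n) :
    ∃ m : ℕ, ∀ w w' : ℕ → W, (∀ k < m, w k = w' k) → t.labelEval c w = t.labelEval c w' := by
  induction t with
  | var i => exact ⟨1, fun w w' h => by simp only [labelEval, h 0 one_pos]⟩
  | one => exact ⟨0, fun w w' h => rfl⟩
  | add s t hs ht =>
    obtain ⟨k, hk⟩ := hs
    obtain ⟨l, hl⟩ := ht
    refine ⟨max k l, fun w w' h => ?_⟩
    simp only [labelEval]
    rw [hk w w' fun i hi => h i (lt_max_of_lt_left hi),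
      hl w w' fun i hi => h i (lt_max_of_lt_right hi)]
  | mul s t hs ht =>
    obtain ⟨k, hk⟩ := hs
    obtain ⟨l, hl⟩ := ht
    refine ⟨max k l, fun w w' h => ?_⟩
    simp only [labelEval]
    rw [hk w w' fun i hi => h i (lt_max_of_lt_left hi),
      hl w w' fun i hi => h i (lt_max_of_lt_right hi)]
  | smul a t ht =>
    obtain ⟨k, hk⟩ := ht
    exact ⟨k, fun w w' h => by simp only [labelEval, hk w w' h]⟩
  | star t ht =>
    obtain ⟨k, hk⟩ := ht
    exact ⟨k, fun w w' h => by simp only [labelEval, hk w w' h]⟩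
  | aut t ht =>
    obtain ⟨k, hk⟩ := ht
    exact ⟨k + 1, fun w w' h => hk _ _ fun i hi => h (i + 1) (by omega)⟩

section

variable {X : Type*} [TopologicalSpace X] [CompactSpace X]

theorem Term.eval_apply_eq_labelEval (S : X ≃ₜ X) {n : ℕ} {W : Type} {c : Fin n → W → ℂ}
    {P : X → W} {v : Fin n → C(X, ℂ)} (hv : ∀ i x, v i x = c i (P x)) (t : Term n) (x : X) :
    t.eval (inducedAut S) v x = t.labelEval c fun k => P (S^[k] x) := by
  induction t generalizing x with
  | var i => exact hv i x
  | one => rfl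
  | add s t hs ht => simp only [eval, labelEval, ← hs, ← ht]; rfl
  | mul s t hs ht => simp only [eval, labelEval, ← hs, ← ht]; rfl
  | smul a t ht => simp only [eval, labelEval, ← ht]; rfl
  | star t ht => simp only [eval, labelEval, ← ht]; rfl
  | aut t ht =>
    simp only [eval, labelEval, inducedAut_apply, ht]
    rfl

theorem norm_le_norm_of_forall_exists {Y : Type*} [TopologicalSpace Y] [CompactSpace Y]
    {f : C(X, ℂ)} {g : C(Y, ℂ)} (h : ∀ x, ∃ y, f x = g y) : ‖f‖ ≤ ‖g‖ := by
  rw [ContinuousMap.norm_le _ (norm_nonneg _)]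
  intro x
  obtain ⟨y, hy⟩ := h x
  rw [hy]
  exact g.norm_coe_le_norm y

/-- By zero-dimensionality and compactness the cover is refined by finitely many clopen sets. A
point is labelled by a function of its membership vector in these sets, which is locally constant.
-/
theorem exists_labelling_of_cover [T2Space X] [TotallyDisconnectedSpace X] {V : Type*}
    [TopologicalSpace V] [Nonempty V] {O : V → Set X}
    (hO : ∀ v, IsOpen (O v)) (hcov : ∀ x, ∃ v, x ∈ O v) : ∃ Q : C(X, V), ∀ x, x ∈ O (Q x) := by
  choose v hv using hcov
  have hU : ∀ x, ∃ U : Set X, IsClopen U ∧ x ∈ U ∧ U ⊆ O (v x) := fun x =>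
    compact_exists_isClopen_in_isOpen (hO _) (hv x)
  choose U hUc hxU hUO using hU
  obtain ⟨s, hs⟩ := isCompact_univ.elim_nhds_subcover U fun x _ =>
    (hUc x).isOpen.mem_nhds (hxU x)
  classical
  let β : X → s → Bool := fun x i => decide (x ∈ U i)
  have hβ : IsLocallyConstant β := by
    rw [IsLocallyConstant.iff_continuous]
    refine continuous_pi fun i => ?_
    exact (IsLocallyConstant.iff_continuous _).1
      ((IsLocallyConstant.iff_exists_open _).2 fun x => by
        by_cases hx : x ∈ U i
        · exact ⟨U i, (hUc i).isOpen, hx, fun y hy => by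
            change decide (y ∈ U i) = decide (x ∈ U i)
            exact decide_eq_decide.2 (iff_of_true hy hx)⟩
        · exact ⟨(U i)ᶜ, (hUc i).compl.isOpen, hx, fun y hy => by
            change decide (y ∈ U i) = decide (x ∈ U i)
            exact decide_eq_decide.2 (iff_of_false hy hx)⟩)
  -- The default value is never attained on `β x`, since the sets `U i` cover.
  let pick : (s → Bool) → V := fun b =>
    if h : ∃ i, b i = true then v h.choose else Classical.arbitrary V
  refine ⟨⟨fun x => pick (β x), (hβ.comp pick).continuous⟩, fun x => ?_⟩
  have hx : ∃ i, β x i = true := by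
    have := hs.2 (mem_univ x)
    simp only [mem_iUnion] at this
    obtain ⟨i, hi, hx⟩ := this
    exact ⟨⟨i, hi⟩, by simpa [β] using hx⟩
  have : pick (β x) = v hx.choose := dif_pos hx
  change x ∈ O (pick (β x))
  rw [this]
  exact hUO _ (by simpa [β] using hx.choose_spec)

end

/-- The net is indexed by Boolean words so that choosing a net-valued function is choosing `l`
clopen sets. Words that code no net point are sent to arbitrary net points, so the norm bound holds
for all words. -/
theorem exists_finite_net (r : ℕ) {δ : ℝ} (hδ : 0 < δ) :
    ∃ (l : ℕ) (e : (Fin l → Bool) → ℂ), (∀ b, ‖e b‖ ≤ r) ∧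
      ∀ z : ℂ, ‖z‖ ≤ r → ∃ b, ‖z - e b‖ < δ := by
  obtain ⟨t, htr, htf, ht⟩ := (isCompact_closedBall (0 : ℂ) (r : ℝ)).finite_cover_balls hδ
  have : Finite t := htf
  obtain ⟨l, ⟨f⟩⟩ := Finite.exists_equiv_fin t
  have h0 : t.Nonempty := by
    have := ht (Metric.mem_closedBall_self (x := (0 : ℂ)) (Nat.cast_nonneg r))
    simp only [mem_iUnion] at this
    exact this.imp fun x hx => hx.1
  have : Nonempty t := h0.to_subtype
  let g : t → Fin l → Bool := fun z i => decide (f z = i)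
  have hg : Function.Injective g := fun z z' h => by
    have := congrFun h (f z)
    simp only [g, decide_true] at this
    exact (f.injective (of_decide_eq_true this.symm)).symm
  refine ⟨l, fun b => (Function.invFun g b : t), fun b => ?_, fun z hz => ?_⟩
  · exact mem_closedBall_zero_iff.1 (htr (Function.invFun g b).2)
  · have := ht (mem_closedBall_zero_iff.2 hz)
    simp only [mem_iUnion] at this
    obtain ⟨w, hw, hzw⟩ := this
    refine ⟨g ⟨w, hw⟩, ?_⟩
    simp only [Function.leftInverse_invFun hg ⟨w, hw⟩]
    simpa [dist_eq_norm] using hzw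

section

variable {X Y : Type*} [TopologicalSpace X] [CompactSpace X] [T2Space X]
  [TotallyDisconnectedSpace X] [TopologicalSpace Y] [CompactSpace Y] [T2Space Y]
  [TotallyDisconnectedSpace Y]

theorem exists_simple_approximation {r : ℕ} {δ : ℝ} {l : ℕ} {e : (Fin l → Bool) → ℂ}
    (he : ∀ z : ℂ, ‖z‖ ≤ r → ∃ b, ‖z - e b‖ < δ) (g : C(X, ℂ)) (hg : ‖g‖ ≤ r) :
    ∃ Q : C(X, Fin l → Bool), ∀ x, ‖g x - e (Q x)‖ < δ :=
  exists_labelling_of_cover (O := fun b => {x | ‖g x - e b‖ < δ})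
    (fun b => isOpen_lt (by fun_prop) continuous_const)
    fun x => he _ ((g.norm_coe_le_norm x).trans hg)

omit [T2Space Y] [TotallyDisconnectedSpace Y] in
/-- Any element of the ball of radius `r` in `C(X)` can be answered by one of `C(Y)`. -/
theorem exists_ball_answer (S : X ≃ₜ X) (T : Y ≃ₜ Y) {n : ℕ} {φ : Formula (n + 1)} {r l d m : ℕ}
    {R δ ε : ℝ} (hδ : 0 < δ)
    (hφX : ∀ v w : Fin (n + 1) → C(X, ℂ), (∀ i, ‖v i‖ ≤ max R r) → (∀ i, ‖w i‖ ≤ max R r) →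
      (∀ i, ‖v i - w i‖ ≤ δ) → |φ.eval (inducedAut S) v - φ.eval (inducedAut S) w| ≤ ε)
    {e : (Fin l → Bool) → ℂ} (her : ∀ b, ‖e b‖ ≤ r)
    (he : ∀ z : ℂ, ‖z‖ ≤ r → ∃ b, ‖z - e b‖ < δ) {W : Type} {c : Fin n → W → ℂ}
    (hc : ∀ i w, ‖c i w‖ ≤ R) (hR : 0 ≤ R)
    (hφ : ∀ (P : X → W × (Fin l → Bool)) (v : Fin (n + 1) → C(X, ℂ))
      (P' : Y → W × (Fin l → Bool)) (v' : Fin (n + 1) → C(Y, ℂ)),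
      (∀ i x, v i x = (Fin.snoc (fun i w => c i w.1) fun w => e w.2 :
        Fin (n + 1) → W × (Fin l → Bool) → ℂ) i (P x)) →
      (∀ i x, v' i x = (Fin.snoc (fun i w => c i w.1) fun w => e w.2 :
        Fin (n + 1) → W × (Fin l → Bool) → ℂ) i (P' x)) →
      pattern S m d P = pattern T m d P' →
      |φ.eval (inducedAut S) v - φ.eval (inducedAut T) v'| ≤ ε)
    {P : X → W} {v : Fin n → C(X, ℂ)} {P' : Y → W} {v' : Fin n → C(Y, ℂ)}
    (hv : ∀ i x, v i x = c i (P x)) (hv' : ∀ i x, v' i x = c i (P' x))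
    (h : pattern S m (d + l) P = pattern T m (d + l) P')
    (g : Metric.closedBall (0 : C(X, ℂ)) (r : ℝ)) :
    ∃ g' : Metric.closedBall (0 : C(Y, ℂ)) (r : ℝ),
      |φ.eval (inducedAut S) (Fin.snoc v (g : C(X, ℂ))) -
        φ.eval (inducedAut T) (Fin.snoc v' (g' : C(Y, ℂ)))| ≤ ε + ε := by
  obtain ⟨g, hg⟩ := g
  rw [mem_closedBall_zero_iff] at hg
  -- Replacing `g` by the step function `e ∘ Q` costs one `ε`; passing from `Q` to its answer `Q'`
  -- in the other system costs the second.
  obtain ⟨Q, hQ⟩ := exists_simple_approximation he g hg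
  obtain ⟨Q', hQ'⟩ := exists_pattern_extension l h Q
  have hcont : Continuous e := continuous_of_discreteTopology
  let q : C(X, ℂ) := ⟨fun x => e (Q x), hcont.comp Q.continuous⟩
  let q' : C(Y, ℂ) := ⟨fun y => e (Q' y), hcont.comp Q'.continuous⟩
  have hq : ‖q‖ ≤ r := (ContinuousMap.norm_le _ (Nat.cast_nonneg r)).2 fun x => her _
  have hq' : ‖q'‖ ≤ r := (ContinuousMap.norm_le _ (Nat.cast_nonneg r)).2 fun x => her _
  have hvR : ∀ i, ‖v i‖ ≤ R := fun i => (ContinuousMap.norm_le _ hR).2 fun x => by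
    rw [hv]; exact hc _ _
  refine ⟨⟨q', mem_closedBall_zero_iff.2 hq'⟩, ?_⟩
  have h₁ := hφX (Fin.snoc v g) (Fin.snoc v q) (norm_snoc_le hvR hg) (norm_snoc_le hvR hq)
    fun i => by
      refine Fin.lastCases ?_ (fun j => ?_) i
      · simp only [Fin.snoc_last]
        exact (ContinuousMap.norm_le _ hδ.le).2 fun x => (hQ x).le
      · simpa using hδ.le
  have h₂ := hφ (fun x => (P x, Q x)) (Fin.snoc v q) (fun y => (P' y, Q' y)) (Fin.snoc v' q')
    (fun i x => by
      refine Fin.lastCases ?_ (fun j => ?_) i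
      · simp [q]
      · simp [hv])
    (fun i x => by
      refine Fin.lastCases ?_ (fun j => ?_) i
      · simp [q']
      · simp [hv']) hQ'
  exact (abs_sub_le _ _ _).trans (add_le_add h₁ h₂)

/-- The value of a formula at functions of a labelling is determined up to `ε` by a type of the
labelling. -/
theorem Formula.exists_pattern_abs_sub_le (S : X ≃ₜ X) (T : Y ≃ₜ Y) {n : ℕ} (φ : Formula n)
    {W : Type} [Finite W] (c : Fin n → W → ℂ) {ε : ℝ} (hε : 0 < ε) :
    ∃ d m : ℕ, ∀ (P : X → W) (v : Fin n → C(X, ℂ)) (P' : Y → W) (v' : Fin n → C(Y, ℂ)),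
      (∀ i x, v i x = c i (P x)) → (∀ i x, v' i x = c i (P' x)) →
      pattern S m d P = pattern T m d P' →
      |φ.eval (inducedAut S) v - φ.eval (inducedAut T) v'| ≤ ε := by
  have hbound : ∀ {n : ℕ} {W : Type} [Finite W] (c : Fin n → W → ℂ),
      ∃ R : ℝ, 0 ≤ R ∧ ∀ i w, ‖c i w‖ ≤ R := fun {n W} _ c => by
    obtain ⟨R, hR⟩ := exists_upper_bound fun p : Fin n × W => ‖c p.1 p.2‖
    exact ⟨max R 0, le_max_right _ _, fun i w => (hR (i, w)).trans (le_max_left _ _)⟩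
  have hnorm : ∀ {n : ℕ} {W : Type} {c : Fin n → W → ℂ} {R : ℝ}, 0 ≤ R → (∀ i w, ‖c i w‖ ≤ R) →
      (∀ {P : X → W} {v : Fin n → C(X, ℂ)}, (∀ i x, v i x = c i (P x)) → ∀ i, ‖v i‖ ≤ R) ∧
      (∀ {P : Y → W} {v : Fin n → C(Y, ℂ)}, (∀ i x, v i x = c i (P x)) → ∀ i, ‖v i‖ ≤ R) :=
    fun hR hc => ⟨fun hv i => (ContinuousMap.norm_le _ hR).2 fun x => by rw [hv]; exact hc _ _,
      fun hv i => (ContinuousMap.norm_le _ hR).2 fun x => by rw [hv]; exact hc _ _⟩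
  induction φ generalizing W ε with
  | norm t =>
    obtain ⟨m, hm⟩ := t.exists_labelEval_congr c
    refine ⟨0, m, fun P v P' v' hv hv' h => ?_⟩
    -- At depth zero both systems show the same words of length `m`, so the term takes the same
    -- values in both, hence has the same norm.
    rw [pattern_zero_eq_iff] at h
    have : ‖t.eval (inducedAut S) v‖ = ‖t.eval (inducedAut T) v'‖ := by
      refine le_antisymm (norm_le_norm_of_forall_exists fun x => ?_)
        (norm_le_norm_of_forall_exists fun y => ?_)
      · refine (h.1 x).imp fun y hy => ?_
        rw [t.eval_apply_eq_labelEval S hv, t.eval_apply_eq_labelEval T hv']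
        exact hm _ _ fun k hk => hy ⟨k, hk⟩
      · refine (h.2 y).imp fun x hx => ?_
        rw [t.eval_apply_eq_labelEval S hv, t.eval_apply_eq_labelEval T hv']
        exact (hm _ _ fun k hk => hx ⟨k, hk⟩).symm
    simp only [eval, this, sub_self, abs_zero]
    exact hε.le
  | conn u φ ih =>
    obtain ⟨R, hR, hc⟩ := hbound c
    choose B hB using fun i => (φ i).exists_bound (inducedAut S) R
    choose B' hB' using fun i => (φ i).exists_bound (inducedAut T) R
    obtain ⟨C, hC⟩ := exists_upper_bound B
    obtain ⟨C', hC'⟩ := exists_upper_bound B'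
    obtain ⟨δ, hδ, hu⟩ := exists_delta_of_continuous u (max C C') hε
    choose d m h using fun i => ih i c hδ
    obtain ⟨D, hD⟩ := (Set.finite_range d).bddAbove
    obtain ⟨M, hM⟩ := (Set.finite_range m).bddAbove
    refine ⟨D, M, fun P v P' v' hv hv' hp => hu _ _ (fun i => ?_) (fun i => ?_) fun i => ?_⟩
    · exact (hB i v ((hnorm hR hc).1 hv)).trans ((hC i).trans (le_max_left _ _))
    · exact (hB' i v' ((hnorm hR hc).2 hv')).trans ((hC' i).trans (le_max_right _ _))
    · exact h i P v P' v' hv hv' (pattern_mono (hM ⟨i, rfl⟩) (hD ⟨i, rfl⟩) hp)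
  | @sup n r φ ih =>
    obtain ⟨R, hR, hc⟩ := hbound c
    obtain ⟨δ₁, hδ₁, h₁⟩ := φ.exists_delta (inducedAut S) (max R r) (half_pos hε)
    obtain ⟨δ₂, hδ₂, h₂⟩ := φ.exists_delta (inducedAut T) (max R r) (half_pos hε)
    have hδ := lt_min hδ₁ hδ₂
    obtain ⟨l, e, her, he⟩ := exists_finite_net r hδ
    obtain ⟨d, m, h⟩ := ih (Fin.snoc (fun i w => c i w.1) fun w => e w.2 :
      Fin (n + 1) → W × (Fin l → Bool) → ℂ) (half_pos hε)
    -- The extra depth `l` pays for the clopen sets that code a net-valued function.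
    refine ⟨d + l, m, fun P v P' v' hv hv' hp => ?_⟩
    obtain ⟨C, hC⟩ := φ.abs_eval_snoc_le (inducedAut S) R r
    obtain ⟨C', hC'⟩ := φ.abs_eval_snoc_le (inducedAut T) R r
    refine abs_ciSup_sub_ciSup_le (hC v ((hnorm hR hc).1 hv)) (hC' v' ((hnorm hR hc).2 hv'))
      (fun g => ?_) fun g' => ?_
    · rw [← add_halves ε]
      exact exists_ball_answer S T hδ (fun v w hv hw hvw => h₁ v w hv hw fun i =>
        (hvw i).trans (min_le_left _ _)) her he hc hR h hv hv' hp g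
    -- The return direction is the same argument with the two systems exchanged, which is why `δ`
    -- was taken below both moduli.
    · obtain ⟨g, hg⟩ := exists_ball_answer T S hδ (fun v w hv hw hvw => h₂ v w hv hw fun i =>
        (hvw i).trans (min_le_right _ _)) her he hc hR (fun P v P' v' hv hv' hp => by
          rw [abs_sub_comm]; exact h P' v' P v hv' hv hp.symm) hv' hv hp.symm g'
      rw [add_halves, abs_sub_comm] at hg
      exact ⟨g, hg⟩
  | @inf n r φ ih =>
    obtain ⟨R, hR, hc⟩ := hbound c
    obtain ⟨δ₁, hδ₁, h₁⟩ := φ.exists_delta (inducedAut S) (max R r) (half_pos hε)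
    obtain ⟨δ₂, hδ₂, h₂⟩ := φ.exists_delta (inducedAut T) (max R r) (half_pos hε)
    have hδ := lt_min hδ₁ hδ₂
    obtain ⟨l, e, her, he⟩ := exists_finite_net r hδ
    obtain ⟨d, m, h⟩ := ih (Fin.snoc (fun i w => c i w.1) fun w => e w.2 :
      Fin (n + 1) → W × (Fin l → Bool) → ℂ) (half_pos hε)
    refine ⟨d + l, m, fun P v P' v' hv hv' hp => ?_⟩
    obtain ⟨C, hC⟩ := φ.abs_eval_snoc_le (inducedAut S) R r
    obtain ⟨C', hC'⟩ := φ.abs_eval_snoc_le (inducedAut T) R r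
    refine abs_ciInf_sub_ciInf_le (hC v ((hnorm hR hc).1 hv)) (hC' v' ((hnorm hR hc).2 hv'))
      (fun g => ?_) fun g' => ?_
    · rw [← add_halves ε]
      exact exists_ball_answer S T hδ (fun v w hv hw hvw => h₁ v w hv hw fun i =>
        (hvw i).trans (min_le_left _ _)) her he hc hR h hv hv' hp g
    · obtain ⟨g, hg⟩ := exists_ball_answer T S hδ (fun v w hv hw hvw => h₂ v w hv hw fun i =>
        (hvw i).trans (min_le_right _ _)) her he hc hR (fun P v P' v' hv hv' hp => by
          rw [abs_sub_comm]; exact h P' v' P v hv' hv hp.symm) hv' hv hp.symm g'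
      rw [add_halves, abs_sub_comm] at hg
      exact ⟨g, hg⟩

/-- Systems with the same types have the same theory. -/
theorem models_theory_of_pattern_eq (S : X ≃ₜ X) (T : Y ≃ₜ Y)
    (h : ∀ m d, pattern S m d (fun _ => ()) = pattern T m d (fun _ => ())) :
    Models (inducedAut T) (theory (inducedAut S)) := by
  intro φ hφ
  have hφ' : φ.eval (inducedAut S) Fin.elim0 = 0 := hφ
  by_contra hne
  obtain ⟨d, m, hdm⟩ := φ.exists_pattern_abs_sub_le S T (W := Unit) (fun i => i.elim0)
    (half_pos (abs_pos.2 hne))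
  have := hdm (fun _ => ()) Fin.elim0 (fun _ => ()) Fin.elim0 (fun i => i.elim0)
    (fun i => i.elim0) (h m d)
  rw [hφ', zero_sub, abs_neg] at this
  linarith [abs_pos.2 hne]

end

/-! ### Countable families closed under operations -/

/-- The Löwenheim–Skolem closure: countably many finitary operations are applied `ω` times. The
finitely many arguments of an operation all appear by some common stage. -/
theorem exists_countable_closed_family {T ι : Type*} [Countable ι] (ar : ι → ℕ)
    (op : ∀ i, (Fin (ar i) → T) → T) (base : T) :
    ∃ J : Set T, J.Countable ∧ base ∈ J ∧ ∀ i (v : Fin (ar i) → T), (∀ k, v k ∈ J) → op i v ∈ J := by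
  let D : ℕ → Set T := fun n => Nat.rec {base}
    (fun _ s => s ∪ ⋃ i, op i '' {v | ∀ k, v k ∈ s}) n
  have hD : ∀ n, D (n + 1) = D n ∪ ⋃ i, op i '' {v | ∀ k, v k ∈ D n} := fun n => rfl
  have hmono : Monotone D := monotone_nat_of_le_succ fun n => by
    rw [hD]; exact subset_union_left
  refine ⟨⋃ n, D n, countable_iUnion fun n => ?_, mem_iUnion.2 ⟨0, rfl⟩, fun i v hv => ?_⟩
  · induction n with
    | zero => exact countable_singleton base
    | succ n ih =>
      rw [hD]
      exact ih.union (countable_iUnion fun i => (countable_pi fun _ => ih).image _)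
  · simp only [mem_iUnion] at hv ⊢
    choose N hN using hv
    obtain ⟨M, hM⟩ := (Set.finite_range N).bddAbove
    refine ⟨M + 1, ?_⟩
    rw [hD]
    exact Or.inr (mem_iUnion.2 ⟨i, v, fun k => hmono (hM ⟨k, rfl⟩) (hN k), rfl⟩)

theorem isOpen_setOf_forall_mem_eq {J Z : Type*} [TopologicalSpace Z] {f : J → Z → Bool}
    (hf : ∀ j, Continuous (f j)) (F : Finset J) (z : J → Bool) :
    IsOpen {y | ∀ j ∈ F, f j y = z j} := by
  have h : {y | ∀ j ∈ F, f j y = z j} = ⋂ j ∈ F, f j ⁻¹' {z j} := by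
    ext; simp
  rw [h]
  exact isOpen_biInter_finset fun j _ => (isOpen_discrete _).preimage (hf j)

/-! ### Limits of clopen algebras along an ultrafilter -/

section Limit

variable {X : Type*} {J : Type*}

/-- The limit along `U` of the images of `X` in `2^J` under the maps `x ↦ (e j n x)_j`. -/
def limitSpace (U : Ultrafilter ℕ) (e : J → ℕ → X → Bool) : Set (J → Bool) :=
  {y | ∀ F : Finset J, ∀ᶠ n in (U : Filter ℕ), ∃ x, ∀ j ∈ F, e j n x = y j}

variable {U : Ultrafilter ℕ} {e : J → ℕ → X → Bool}

theorem isClosed_limitSpace : IsClosed (limitSpace U e) := by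
  have : limitSpace U e = ⋂ F : Finset J,
      {y : J → Bool | ∀ᶠ n in (U : Filter ℕ), ∃ x, ∀ j ∈ F, e j n x = y j} := by
    ext y; simp [limitSpace]
  rw [this]
  refine isClosed_iInter fun F => ?_
  rw [← isOpen_compl_iff, isOpen_iff_mem_nhds]
  intro y hy
  have hn : {y' : J → Bool | ∀ j ∈ F, y' j = y j} ∈ 𝓝 y :=
    (isOpen_setOf_forall_mem_eq (fun j => continuous_apply j) F y).mem_nhds fun _ _ => rfl
  filter_upwards [hn] with y' hy' h
  refine hy ?_
  filter_upwards [h] with n hn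
  obtain ⟨x, hx⟩ := hn
  exact ⟨x, fun j hj => (hx j hj).trans (hy' j hj)⟩

/-- Realizations `x n` are chosen at `U`-most stages, and every coordinate is given its `U`-limit
along them; the ultrafilter decides each coordinate, so this is a point of the limit. -/
theorem exists_mem_limitSpace {F : Finset J} {z : J → Bool}
    (h : ∀ᶠ n in (U : Filter ℕ), ∃ x, ∀ j ∈ F, e j n x = z j) :
    ∃ y : limitSpace U e, ∀ j ∈ F, y.1 j = z j := by
  classical
  obtain ⟨n₀, x₀, -⟩ := h.exists
  let x : ℕ → X := fun n => if hn : ∃ x, ∀ j ∈ F, e j n x = z j then hn.choose else x₀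
  have hx : ∀ᶠ n in (U : Filter ℕ), ∀ j ∈ F, e j n (x n) = z j := by
    filter_upwards [h] with n hn
    simp only [x, dif_pos hn]
    exact hn.choose_spec
  let y : J → Bool := fun j => decide (∀ᶠ n in (U : Filter ℕ), e j n (x n) = true)
  have hy : ∀ j, ∀ᶠ n in (U : Filter ℕ), e j n (x n) = y j := by
    intro j
    by_cases hj : ∀ᶠ n in (U : Filter ℕ), e j n (x n) = true
    · simp only [y, hj, decide_true]
    · have := Ultrafilter.eventually_not.2 hj
      simpa only [y, hj, decide_false, Bool.not_eq_true] using this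
  refine ⟨⟨y, fun G => ?_⟩, fun j hj => ?_⟩
  · filter_upwards [(G.eventually_all).2 fun j _ => hy j] with n hn
    exact ⟨x n, hn⟩
  · obtain ⟨n, h₁, h₂⟩ := (hx.and (hy j)).exists
    exact h₂.symm.trans (h₁ j hj)

instance limitSpace_compactSpace : CompactSpace (limitSpace U e) :=
  isCompact_iff_compactSpace.1 isClosed_limitSpace.isCompact

/-- Finitely many coordinates of points of the limit are jointly realized along `U`. -/
theorem limitSpace_eventually (y : limitSpace U e) {k : ℕ} (j : Fin k → J) :
    ∀ᶠ n in (U : Filter ℕ), ∃ x, ∀ i, e (j i) n x = y.1 (j i) := by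
  classical
  filter_upwards [y.2 (Finset.univ.image j)] with n hn
  exact hn.imp fun x hx i => hx _ (Finset.mem_image_of_mem j (Finset.mem_univ i))

/-- Relations holding between coordinates at all stages hold on the limit. -/
theorem limitSpace_relation {k : ℕ} {j : Fin k → J} {p : (Fin k → Bool) → Prop}
    (h : ∀ n x, p fun i => e (j i) n x) (y : limitSpace U e) : p fun i => y.1 (j i) := by
  obtain ⟨n, x, hx⟩ := (limitSpace_eventually y j).exists
  simpa only [hx] using h n x

/-- A continuous function on the limit is a coordinate, provided that the coordinates are closed
under Boolean combinations. -/
theorem exists_coordinate_eq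
    (hbool : ∀ (k : ℕ) (j : Fin k → J) (f : (Fin k → Bool) → Bool),
      ∃ b, ∀ n x, e b n x = f fun i => e (j i) n x) (Q : C(limitSpace U e, Bool)) :
    ∃ b : J, ∀ y : limitSpace U e, Q y = y.1 b := by
  classical
  have hloc : ∀ y : limitSpace U e, ∃ F : Finset J,
      ∀ y' : limitSpace U e, (∀ j ∈ F, y'.1 j = y.1 j) → Q y' = Q y := by
    intro y
    have hopen : IsOpen (Q ⁻¹' {Q y}) := (isOpen_discrete _).preimage Q.continuous
    obtain ⟨O, hO, hOQ⟩ := isOpen_induced_iff.1 hopen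
    have hyO : y.1 ∈ O := by
      have : y ∈ Subtype.val ⁻¹' O := by rw [hOQ]; rfl
      exact this
    obtain ⟨F, u, hu, huO⟩ := isOpen_pi_iff.1 hO y.1 hyO
    refine ⟨F, fun y' hy' => ?_⟩
    have : y' ∈ Subtype.val ⁻¹' O := huO fun j hj => by
      rw [hy' j hj]; exact (hu j hj).2
    rw [hOQ] at this
    exact this
  choose F hF using hloc
  have hFopen : ∀ y : limitSpace U e,
      {y' : limitSpace U e | ∀ j ∈ F y, y'.1 j = y.1 j} ∈ 𝓝 y := by
    exact fun y => (isOpen_setOf_forall_mem_eq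
      (fun j => (continuous_apply j).comp continuous_subtype_val) (F y) y.1).mem_nhds fun _ _ => rfl
  obtain ⟨t, ht⟩ := isCompact_univ.elim_nhds_subcover _ fun y _ => hFopen y
  let G := t.biUnion F
  have hG : ∀ y y' : limitSpace U e, (∀ j ∈ G, y.1 j = y'.1 j) → Q y = Q y' := by
    intro y y' h
    have := ht.2 (mem_univ y)
    simp only [mem_iUnion] at this
    obtain ⟨z, hz, hyz⟩ := this
    rw [hF z y hyz, hF z y' fun j hj =>
      (h j (Finset.mem_biUnion.2 ⟨z, hz, hj⟩)).symm.trans (hyz j hj)]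
  let enum : Fin G.card → J := fun i => (G.equivFin.symm i).1
  have henum : ∀ j ∈ G, ∃ i, enum i = j := fun j hj =>
    ⟨G.equivFin ⟨j, hj⟩, by simp [enum]⟩
  -- By compactness `Q` depends only on the coordinates in `G`. This is the Boolean function through
  -- which it factors, set to `false` on vectors not occurring in the limit.
  let f : (Fin G.card → Bool) → Bool := fun z =>
    decide (∃ y : limitSpace U e, (∀ i, y.1 (enum i) = z i) ∧ Q y = true)
  obtain ⟨b, hb⟩ := hbool _ enum f
  refine ⟨b, fun y => ?_⟩
  have hyb : y.1 b = f fun i => y.1 (enum i) := by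
    have := limitSpace_relation (U := U) (e := e) (j := (Fin.snoc enum b : Fin (G.card + 1) → J))
      (p := fun z => z (Fin.last _) = f fun i => z i.castSucc)
      (fun n x => by simpa using hb n x) y
    simpa using this
  rw [hyb, Bool.eq_iff_iff]
  simp only [f, decide_eq_true_eq]
  constructor
  · exact fun h => ⟨y, fun _ => rfl, h⟩
  · rintro ⟨y', hy', hQ⟩
    rw [← hQ]
    refine hG _ _ fun j hj => ?_
    obtain ⟨i, rfl⟩ := henum j hj
    exact (hy' i).symm

variable [TopologicalSpace X] {S : X ≃ₜ X} {s : J ≃ J}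

theorem mem_limitSpace_comp (hs : ∀ j n x, e (s j) n x = e j n (S x)) {y : J → Bool} :
    y ∘ s ∈ limitSpace U e ↔ y ∈ limitSpace U e := by
  classical
  constructor
  · intro h F
    filter_upwards [h (F.image s.symm)] with n hn
    obtain ⟨x, hx⟩ := hn
    refine ⟨S.symm x, fun j hj => ?_⟩
    have := hx _ (Finset.mem_image_of_mem s.symm hj)
    rw [Function.comp_apply, s.apply_symm_apply] at this
    rw [← this, ← s.apply_symm_apply j, hs, S.apply_symm_apply, s.apply_symm_apply]
  · intro h F
    filter_upwards [h (F.image s)] with n hn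
    obtain ⟨x, hx⟩ := hn
    refine ⟨S x, fun j hj => ?_⟩
    rw [← hs]
    exact hx _ (Finset.mem_image_of_mem s hj)

/-- The homeomorphism of the limit which is induced by a permutation of the coordinates. -/
def limitHomeo (U : Ultrafilter ℕ) (hs : ∀ j n x, e (s j) n x = e j n (S x)) :
    limitSpace U e ≃ₜ limitSpace U e where
  toFun y := ⟨y.1 ∘ s, (mem_limitSpace_comp hs).2 y.2⟩
  invFun y := ⟨y.1 ∘ s.symm, (mem_limitSpace_comp hs).1 (by
    rw [Function.comp_assoc, Equiv.symm_comp_self]; exact y.2)⟩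
  left_inv y := Subtype.ext (by simp [Function.comp_assoc])
  right_inv y := Subtype.ext (by simp [Function.comp_assoc])
  continuous_toFun := ((Pi.continuous_precomp s).comp continuous_subtype_val).subtype_mk _
  continuous_invFun := ((Pi.continuous_precomp s.symm).comp continuous_subtype_val).subtype_mk _

theorem limitHomeo_apply (hs : ∀ j n x, e (s j) n x = e j n (S x)) (y : limitSpace U e) (j : J) :
    (limitHomeo U hs y).1 j = y.1 (s j) := rfl

theorem limitHomeo_iterate_apply (hs : ∀ j n x, e (s j) n x = e j n (S x)) (i : ℕ)
    (y : limitSpace U e) (j : J) : ((limitHomeo U hs)^[i] y).1 j = y.1 (s^[i] j) := by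
  induction i generalizing y with
  | zero => rfl
  | succ i ih =>
    rw [Function.iterate_succ_apply, ih, Function.iterate_succ_apply', limitHomeo_apply]

theorem apply_iterate_index (hs : ∀ j n x, e (s j) n x = e j n (S x)) (i : ℕ) (j : J) (n : ℕ)
    (x : X) : e (s^[i] j) n x = e j n (S^[i] x) := by
  induction i generalizing x with
  | zero => rfl
  | succ i ih => rw [Function.iterate_succ_apply', hs, ih, Function.iterate_succ_apply]

/-- A word occurs in the limit if and only if it occurs along `U`. -/
theorem limitHomeo_word_iff (hs : ∀ j n x, e (s j) n x = e j n (S x)) {k m : ℕ} (j : Fin k → J)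
    (w : Fin m → Fin k → Bool) :
    (∃ y : limitSpace U e, ∀ i : Fin m, (fun a => ((limitHomeo U hs)^[i] y).1 (j a)) = w i) ↔
      ∀ᶠ n in (U : Filter ℕ), ∃ x, ∀ i : Fin m, (fun a => e (j a) n (S^[i] x)) = w i := by
  classical
  constructor
  · rintro ⟨y, hy⟩
    filter_upwards [y.2 (Finset.univ.image fun p : Fin m × Fin k => s^[p.1] (j p.2))] with n hn
    refine hn.imp fun x hx i => ?_
    rw [← hy]
    funext a
    rw [limitHomeo_iterate_apply, ← apply_iterate_index hs]
    exact hx _ (Finset.mem_image_of_mem (fun p : Fin m × Fin k => s^[p.1] (j p.2))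
      (Finset.mem_univ (i, a)))
  · intro h
    obtain ⟨n₁, x₁, hx₁⟩ := h.exists
    let F := Finset.univ.image fun p : Fin m × Fin k => s^[p.1] (j p.2)
    -- The target values are read off from a sample point rather than from `w`, because different
    -- pairs `(i, a)` may name the same coordinate.
    obtain ⟨y, hy⟩ := exists_mem_limitSpace (U := U) (e := e) (F := F)
      (z := fun b => e b n₁ x₁) (by
        filter_upwards [h] with n hn
        obtain ⟨x, hx⟩ := hn
        refine ⟨x, fun b hb => ?_⟩
        obtain ⟨⟨i, a⟩, -, rfl⟩ := Finset.mem_image.1 hb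
        simp only [apply_iterate_index hs]
        exact congrFun ((hx i).trans (hx₁ i).symm) a)
    refine ⟨y, fun i => ?_⟩
    rw [← hx₁ i]
    funext a
    rw [limitHomeo_iterate_apply, ← apply_iterate_index hs]
    exact hy _ (Finset.mem_image_of_mem (fun p : Fin m × Fin k => s^[p.1] (j p.2))
      (Finset.mem_univ (i, a)))

/-- Types in the limit are limits of types. -/
theorem eventually_pattern_eq {e : J → ℕ → C(X, Bool)}
    (hs : ∀ j n x, e (s j) n x = e j n (S x))
    (hbool : ∀ (k : ℕ) (j : Fin k → J) (f : (Fin k → Bool) → Bool),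
      ∃ b, ∀ n x, e b n x = f fun i => e (j i) n x)
    (hwit : ∀ (k m d : ℕ) (j : Fin k → J) (t : Pattern m d ((Fin k → Bool) × Bool)),
      ∃ b, ∀ n, (∃ Q : C(X, Bool), pattern S m d (fun x => (fun i => e (j i) n x, Q x)) = t) →
        pattern S m d (fun x => (fun i => e (j i) n x, e b n x)) = t)
    (m d : ℕ) {k : ℕ} (j : Fin k → J) :
    ∀ᶠ n in (U : Filter ℕ), pattern S m d (fun x i => e (j i) n x) =
      pattern (limitHomeo U (e := fun j n x => e j n x) hs) m d (fun y i => y.1 (j i)) := by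
  induction d generalizing k with
  | zero =>
    have : ∀ w : Fin m → Fin k → Bool, ∀ᶠ n in (U : Filter ℕ),
        ((∃ x, ∀ i : Fin m, (fun a => e (j a) n (S^[i] x)) = w i) ↔
          ∃ y, ∀ i : Fin m,
            (fun a => ((limitHomeo U (e := fun j n x => e j n x) hs)^[i] y).1 (j a)) = w i) := by
      intro w
      rw [limitHomeo_word_iff]
      by_cases h : ∀ᶠ n in (U : Filter ℕ),
          ∃ x, ∀ i : Fin m, (fun a => e (j a) n (S^[i] x)) = w i
      · filter_upwards [h] with n hn using iff_of_true hn h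
      · filter_upwards [Ultrafilter.eventually_not.2 h] with n hn using iff_of_false hn h
    filter_upwards [eventually_all.2 this] with n hn
    exact Set.ext hn
  | succ d ih =>
    have hext : ∀ b : J, ∀ᶠ n in (U : Filter ℕ),
        pattern S m d (fun x => (fun i => e (j i) n x, e b n x)) =
          pattern (limitHomeo U (e := fun j n x => e j n x) hs) m d
            (fun y => (fun i => y.1 (j i), y.1 b)) := by
      intro b
      filter_upwards [ih (Fin.snoc j b : Fin (k + 1) → J)] with n hn
      have := pattern_comp hn (fun z => (fun i : Fin k => z i.castSucc, z (Fin.last k)))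
      simpa only [Fin.snoc_castSucc, Fin.snoc_last] using this
    have : ∀ t : Pattern m d ((Fin k → Bool) × Bool), ∀ᶠ n in (U : Filter ℕ),
        ((∃ Q : C(X, Bool), pattern S m d (fun x => (fun i => e (j i) n x, Q x)) = t) ↔
          ∃ Q : C(limitSpace U (fun j n x => e j n x), Bool),
            pattern (limitHomeo U (e := fun j n x => e j n x) hs) m d
              (fun y => (fun i => y.1 (j i), Q y)) = t) := by
      intro t
      -- If the limit has an answer, it is a coordinate `b`, and `e b n` is an answer at `U`-most
      -- stages. If it has none, the Skolem coordinate for `t` must fail at `U`-most stages, so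
      -- there is no answer there either.
      by_cases h : ∃ Q : C(limitSpace U (fun j n x => e j n x), Bool),
          pattern (limitHomeo U (e := fun j n x => e j n x) hs) m d
            (fun y => (fun i => y.1 (j i), Q y)) = t
      · obtain ⟨Q, hQ⟩ := h
        obtain ⟨b, hb⟩ := exists_coordinate_eq hbool Q
        filter_upwards [hext b] with n hn
        refine iff_of_true ⟨e b n, ?_⟩ ⟨Q, hQ⟩
        rw [hn, ← hQ]
        simp only [hb]
      · obtain ⟨b, hb⟩ := hwit k m d j t
        filter_upwards [hext b] with n hn
        refine iff_of_false (fun hX => h ⟨⟨fun y => y.1 b,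
          (continuous_apply b).comp continuous_subtype_val⟩, ?_⟩) h
        rw [← hb n hX, hn]
        rfl
    -- Only finitely many `t` exist, so the ultrafilter handles them simultaneously.
    filter_upwards [eventually_all.2 this] with n hn
    exact Set.ext hn

end Limit

/-! ### A characterization of the Cantor set -/

section Characterization

variable {Y : Type*} [TopologicalSpace Y]

/-- If `c` takes both values on `D`, it is itself the split; otherwise it is constant on `D` and any
split will do. Either way `c` is decided by the half of `D`. -/
theorem exists_refining_split (split : ∀ D : C(Y, Bool), (∃ y, D y = true) →
      ∃ E : C(Y, Bool), ∀ b, ∃ y, D y = true ∧ E y = b) (c D : C(Y, Bool)) :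
    ∃ E : C(Y, Bool), ((∃ y, D y = true) → ∀ b, ∃ y, D y = true ∧ E y = b) ∧
      ∀ y y', D y = true → D y' = true → E y = E y' → c y = c y' := by
  by_cases hD : ∃ y, D y = true
  · by_cases hc : ∀ b, ∃ y, D y = true ∧ c y = b
    · exact ⟨c, fun _ => hc, fun _ _ _ _ h => h⟩
    · obtain ⟨E, hE⟩ := split D hD
      refine ⟨E, fun _ => hE, fun y y' hy hy' _ => ?_⟩
      push Not at hc
      obtain ⟨b, hb⟩ := hc
      rw [Bool.eq_not_of_ne (hb y hy), Bool.eq_not_of_ne (hb y' hy')]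
  · exact ⟨c, fun h => absurd h hD, fun _ _ _ _ h => h⟩

/-- A compact Hausdorff space in which countably many clopen sets separate points and every
nonempty clopen set splits is homeomorphic to the Cantor set. -/
theorem nonempty_homeomorph_cantor [CompactSpace Y] [T2Space Y] [Nonempty Y] (c : ℕ → C(Y, Bool))
    (hsep : ∀ y y', (∀ n, c n y = c n y') → y = y')
    (split : ∀ D : C(Y, Bool), (∃ y, D y = true) →
      ∃ E : C(Y, Bool), ∀ b, ∃ y, D y = true ∧ E y = b) :
    Nonempty (Y ≃ₜ Cantor) := by
  choose E hE hEc using fun n => exists_refining_split split (c n)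
  let next : ℕ → C(Y, Bool) → Y → C(Y, Bool) := fun n D y =>
    ⟨fun z => D z && (E n D z == E n D y),
      (continuous_of_discreteTopology (f := fun p : Bool × Bool => p.1 && (p.2 == E n D y))).comp
        (D.continuous.prodMk (E n D).continuous)⟩
  -- `cell n y` consists of the points that took the same halves as `y` in the first `n` splittings;
  -- the sequence of halves is the address `h y`.
  let cell : ℕ → Y → C(Y, Bool) := fun n y => Nat.rec (ContinuousMap.const Y true)
    (fun n D => next n D y) n
  have cell_succ : ∀ n y, cell (n + 1) y = next n (cell n y) y := fun n y => rfl
  have next_apply : ∀ n D y z, next n D y z = true ↔ D z = true ∧ E n D z = E n D y := by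
    intro n D y z
    simp [next]
  let h : Y → Cantor := fun y n => E n (cell n y) y
  have cell_self : ∀ n y, cell n y y = true := by
    intro n y
    induction n with
    | zero => rfl
    | succ n ih => rw [cell_succ, next_apply]; exact ⟨ih, rfl⟩
  have cell_eq : ∀ n y z, cell n y z = true → cell n z = cell n y ∧ ∀ i < n, h z i = h y i := by
    intro n y z
    induction n with
    | zero => exact fun _ => ⟨rfl, fun i hi => absurd hi (Nat.not_lt_zero i)⟩
    | succ n ih =>
      rw [cell_succ, next_apply]
      rintro ⟨h₁, h₂⟩
      obtain ⟨h₃, h₄⟩ := ih h₁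
      refine ⟨?_, fun i hi => ?_⟩
      · rw [cell_succ, h₃]
        ext w
        simp only [next, ContinuousMap.coe_mk, h₂]
      · rcases Nat.lt_succ_iff_lt_or_eq.1 hi with hi | rfl
        · exact h₄ i hi
        · simp only [h, h₃, h₂]
  have hcont : Continuous h := by
    refine continuous_pi fun n => continuous_iff_continuousAt.2 fun y => ?_
    refine ((E n (cell n y)).continuous.continuousAt (x := y)).congr ?_
    have : (cell n y) ⁻¹' {true} ∈ 𝓝 y :=
      ((isOpen_discrete _).preimage (cell n y).continuous).mem_nhds (cell_self n y)
    filter_upwards [this] with z hz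
    simp only [h, (cell_eq n y z hz).1]
  have hinj : Function.Injective h := by
    intro y z hyz
    have hcell : ∀ n, cell n y z = true := by
      intro n
      induction n with
      | zero => rfl
      | succ n ih =>
        rw [cell_succ, next_apply]
        refine ⟨ih, ?_⟩
        have := congrFun hyz n
        simp only [h, (cell_eq n y z ih).1] at this
        exact this.symm
    refine hsep y z fun n => hEc n (cell n y) y z (cell_self n y) (hcell n) ?_
    have := hcell (n + 1)
    rw [cell_succ, next_apply] at this
    exact this.2.symm
  have hdense : ∀ (b : Cantor) (n : ℕ), ∃ y, ∀ i < n, h y i = b i := by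
    intro b n
    induction n with
    | zero => exact ⟨Classical.arbitrary Y, fun i hi => absurd hi (Nat.not_lt_zero i)⟩
    | succ n ih =>
      obtain ⟨y, hy⟩ := ih
      obtain ⟨z, hz, hzb⟩ := hE n (cell n y) ⟨y, cell_self n y⟩ (b n)
      obtain ⟨h₁, h₂⟩ := cell_eq n y z hz
      refine ⟨z, fun i hi => ?_⟩
      rcases Nat.lt_succ_iff_lt_or_eq.1 hi with hi | rfl
      · rw [h₂ i hi, hy i hi]
      · simp only [h, h₁, hzb]
  have hsurj : Function.Surjective h := by
    intro b
    have hclosed : IsClosed (range h) := (isCompact_range hcont).isClosed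
    have : b ∈ closure (range h) := by
      rw [mem_closure_iff]
      intro O hO hb
      obtain ⟨F, u, hu, huO⟩ := isOpen_pi_iff.1 hO b hb
      obtain ⟨y, hy⟩ := hdense b (F.sup id + 1)
      refine ⟨h y, huO fun i hi => ?_, mem_range_self y⟩
      rw [hy i (Nat.lt_succ_of_le (Finset.le_sup (f := id) hi))]
      exact (hu i hi).2
    rwa [hclosed.closure_eq] at this
  exact ⟨Continuous.homeoOfEquivCompactToT2 (f := Equiv.ofBijective h ⟨hinj, hsurj⟩) hcont⟩

theorem cantor_exists_split (D : C(Cantor, Bool)) (hD : ∃ x, D x = true) :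
    ∃ E : C(Cantor, Bool), ∀ b, ∃ x, D x = true ∧ E x = b := by
  obtain ⟨x, hx⟩ := hD
  have hO : IsOpen (D ⁻¹' {true}) := (isOpen_discrete _).preimage D.continuous
  obtain ⟨F, u, hu, huO⟩ := isOpen_pi_iff.1 hO x hx
  obtain ⟨i, hi⟩ := Infinite.exists_notMem_finset F
  refine ⟨⟨fun x => x i, continuous_apply i⟩, fun b => ⟨Function.update x i b, ?_, ?_⟩⟩
  · refine huO fun j hj => ?_
    rw [Function.update_of_ne (by rintro rfl; exact hi hj)]
    exact (hu j hj).2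
  · simp

end Characterization

/-! ### The homeomorphism group of the Cantor set -/

/-- The image consists of the pairs of mutually inverse maps, a closed condition since composition
is continuous for locally compact `X`. Complete metrizability, hence Baire category, is inherited
from the mapping space. -/
theorem isClosedEmbedding_homeo {X : Type*} [TopologicalSpace X] [LocallyCompactSpace X]
    [T2Space X] :
    IsClosedEmbedding (fun f : X ≃ₜ X => ((f : C(X, X)), (f.symm : C(X, X)))) := by
  refine ⟨⟨⟨rfl⟩, fun f g h => ?_⟩, ?_⟩
  · exact Homeomorph.ext fun x => DFunLike.congr_fun (Prod.ext_iff.1 h).1 x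
  · have : range (fun f : X ≃ₜ X => ((f : C(X, X)), (f.symm : C(X, X)))) =
        {p | p.1.comp p.2 = ContinuousMap.id X} ∩ {p | p.2.comp p.1 = ContinuousMap.id X} := by
      ext ⟨f, g⟩
      constructor
      · rintro ⟨h, hh⟩
        obtain ⟨rfl, rfl⟩ := Prod.ext_iff.1 hh
        exact ⟨ContinuousMap.ext h.apply_symm_apply, ContinuousMap.ext h.symm_apply_apply⟩
      · rintro ⟨h₁, h₂⟩
        exact ⟨⟨⟨f, g, DFunLike.congr_fun h₂, DFunLike.congr_fun h₁⟩, f.continuous,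
          g.continuous⟩, rfl⟩
    rw [this]
    exact (isClosed_eq (continuous_fst.compCM continuous_snd) continuous_const).inter
      (isClosed_eq (continuous_snd.compCM continuous_fst) continuous_const)

theorem homeo_baireSpace (X : Type*) [TopologicalSpace X] [CompactSpace X]
    [TopologicalSpace.IsCompletelyMetrizableSpace X] : BaireSpace (X ≃ₜ X) := by
  let := TopologicalSpace.upgradeIsCompletelyMetrizable X
  have := (isClosedEmbedding_homeo (X := X)).IsCompletelyMetrizableSpace
  infer_instance

instance cantor_homeo_baireSpace : BaireSpace (Cantor ≃ₜ Cantor) :=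
  homeo_baireSpace Cantor

theorem IsGeneric.exists_mem_of_isOpen {σ : Cantor ≃ₜ Cantor} (hσ : IsGeneric σ)
    {O : Set (Cantor ≃ₜ Cantor)} (hO : IsOpen O) (hne : O.Nonempty) :
    ∃ τ ∈ O, TopConj σ τ :=
  (dense_of_mem_residual hσ).inter_open_nonempty O hO hne

/-! ### Return times -/

section ReturnTimes

variable {X Y : Type*} [TopologicalSpace X] [TopologicalSpace Y]

/-- The set of `k` such that some point of the clopen set `a` returns to `a` at time `k + 1`. -/
def returnTimes (S : X ≃ₜ X) (a : C(X, Bool)) : Set ℕ :=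
  {k | ∃ x, a x = true ∧ a (S^[k + 1] x) = true}

theorem returnTimes_conj {S : X ≃ₜ X} {T : Y ≃ₜ Y} (g : X ≃ₜ Y) (hg : ∀ x, g (S x) = T (g x))
    (a : C(Y, Bool)) : returnTimes S (a.comp (g : C(X, Y))) = returnTimes T a := by
  have hit : ∀ (i : ℕ) x, g (S^[i] x) = T^[i] (g x) := fun i x =>
    Function.Semiconj.iterate_right (f := g) hg i x
  ext k
  constructor
  · rintro ⟨x, h₁, h₂⟩
    exact ⟨g x, h₁, by rw [← hit]; exact h₂⟩
  · rintro ⟨y, h₁, h₂⟩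
    refine ⟨g.symm y, ?_, ?_⟩
    · change a (g (g.symm y)) = true
      rw [g.apply_symm_apply, h₁]
    · change a (g _) = true
      rw [hit, g.apply_symm_apply, h₂]

theorem continuous_homeo_iterate [LocallyCompactSpace X] [T2Space X] (k : ℕ) :
    Continuous fun f : X ≃ₜ X => (⟨f^[k], f.continuous.iterate k⟩ : C(X, X)) := by
  have h1 : Continuous fun f : X ≃ₜ X => (f : C(X, X)) :=
    continuous_fst.comp (isClosedEmbedding_homeo (X := X)).continuous
  induction k with
  | zero => exact continuous_const (y := ContinuousMap.id X)
  | succ k ih => exact ih.compCM h1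

/-- Not returning means mapping the compact set `a` into its open complement, a subbasic open
condition; returning is witnessed by one point, and evaluation there is continuous. -/
theorem isClopen_setOf_mem_returnTimes [CompactSpace X] [T2Space X] (a : C(X, Bool)) (k : ℕ) :
    IsClopen {S : X ≃ₜ X | k ∈ returnTimes S a} := by
  have : IsClopen {f : C(X, X) | ∃ x, a x = true ∧ a (f x) = true} := by
    constructor
    · rw [← isOpen_compl_iff]
      have h : {f : C(X, X) | ∃ x, a x = true ∧ a (f x) = true}ᶜ =
          {f : C(X, X) | MapsTo f (a ⁻¹' {true}) (a ⁻¹' {false})} := by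
        ext f
        simp [MapsTo]
      rw [h]
      exact ContinuousMap.isOpen_setOfPred_mapsTo
        ((isClosed_discrete _).preimage a.continuous).isCompact
        ((isOpen_discrete _).preimage a.continuous)
    · have h : {f : C(X, X) | ∃ x, a x = true ∧ a (f x) = true} =
          ⋃ x ∈ a ⁻¹' {true}, {f : C(X, X) | a (f x) = true} := by
        ext f
        simp
      rw [h]
      exact isOpen_biUnion fun x _ => (isOpen_discrete {true}).preimage
        (a.continuous.comp (continuous_eval_const x))
  exact this.preimage (continuous_homeo_iterate (k + 1))

theorem isOpen_setOf_exists_returnTimes [CompactSpace X] [T2Space X] (A : Set ℕ) (m : ℕ) :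
    IsOpen {S : X ≃ₜ X | ∃ a, ∀ k < m, (k ∈ returnTimes S a ↔ k ∈ A)} := by
  have h : {S : X ≃ₜ X | ∃ a, ∀ k < m, (k ∈ returnTimes S a ↔ k ∈ A)} =
      ⋃ a, ⋂ k ∈ Finset.range m, {S : X ≃ₜ X | k ∈ returnTimes S a ↔ k ∈ A} := by
    ext S
    simp
  rw [h]
  refine isOpen_iUnion fun a => isOpen_biInter_finset fun k _ => ?_
  by_cases hk : k ∈ A
  · simpa only [hk, iff_true] using (isClopen_setOf_mem_returnTimes a k).isOpen
  · simp only [hk, iff_false]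
    exact (isClopen_setOf_mem_returnTimes a k).compl.isOpen

end ReturnTimes

/-! ### Prescribing finitely many return times -/

/-- The two-sided full shift. -/
def fullShift : (ℤ → Bool) ≃ₜ (ℤ → Bool) where
  toFun y i := y (i + 1)
  invFun y i := y (i - 1)
  left_inv y := by simp
  right_inv y := by simp
  continuous_toFun := by fun_prop
  continuous_invFun := by fun_prop

theorem fullShift_iterate_apply (k : ℕ) (y : ℤ → Bool) (i : ℤ) :
    fullShift^[k] y i = y (i + k) := by
  induction k generalizing y with
  | zero => simp
  | succ k ih =>
    rw [Function.iterate_succ_apply, ih]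
    change y (i + k + 1) = _
    push_cast
    rw [add_assoc]

/-- The clopen set demands a `1` at position `0` and a `0` at each position `k + 1` with `k < m`
outside `A`, which forbids the unwanted returns. For `k ∈ A` the sequence with ones exactly at `0`
and `k + 1` returns. -/
theorem fullShift_exists_returnTimes (A : Set ℕ) (m : ℕ) :
    ∃ a, ∀ k < m, (k ∈ returnTimes fullShift a ↔ k ∈ A) := by
  classical
  let f : (Fin (m + 1) → Bool) → Bool := fun z =>
    decide (z 0 = true ∧ ∀ k : Fin m, (k : ℕ) ∉ A → z k.succ = false)
  have hcont : Continuous fun (y : ℤ → Bool) (i : Fin (m + 1)) => y (i : ℕ) :=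
    continuous_pi fun i => continuous_apply ((i : ℕ) : ℤ)
  let a : C(ℤ → Bool, Bool) :=
    ⟨fun y => f fun i => y (i : ℕ), (continuous_of_discreteTopology (f := f)).comp hcont⟩
  have ha : ∀ y, a y = true ↔ y 0 = true ∧ ∀ k < m, k ∉ A → y (k + 1) = false := by
    intro y
    simp only [a, f, ContinuousMap.coe_mk, decide_eq_true_eq]
    refine and_congr (by simp) ⟨fun h k hk hA => ?_, fun h k hA => ?_⟩
    · simpa using h ⟨k, hk⟩ hA
    · simpa using h k k.2 hA
  refine ⟨a, fun k hk => ⟨?_, fun hA => ?_⟩⟩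
  · rintro ⟨y, h₁, h₂⟩
    rw [ha] at h₁ h₂
    by_contra hA
    have h₃ := h₁.2 k hk hA
    have h₄ := h₂.1
    rw [fullShift_iterate_apply, zero_add] at h₄
    push_cast at h₄
    rw [h₃] at h₄
    exact Bool.false_ne_true h₄
  · refine ⟨fun i => decide (i = 0 ∨ i = k + 1), ?_, ?_⟩
    · rw [ha]
      refine ⟨by simp, fun l _ hlA => decide_eq_false ?_⟩
      rintro (h | h)
      · omega
      · exact hlA (by rwa [show l = k by omega])
    · rw [ha]
      refine ⟨?_, fun l _ _ => ?_⟩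
      · rw [fullShift_iterate_apply]
        exact decide_eq_true (Or.inr (by push_cast; ring))
      · rw [fullShift_iterate_apply]
        refine decide_eq_false ?_
        push_cast
        omega

theorem IsGeneric.exists_returnTimes {σ : Cantor ≃ₜ Cantor} (hσ : IsGeneric σ) (A : Set ℕ)
    (m : ℕ) : ∃ a, ∀ k < m, (k ∈ returnTimes σ a ↔ k ∈ A) := by
  obtain ⟨τ, ⟨a, ha⟩, g, hg⟩ := hσ.exists_mem_of_isOpen
    (isOpen_setOf_exists_returnTimes A m) (by
      let g : (ℤ → Bool) ≃ₜ Cantor := Homeomorph.piCongrLeft (Y := fun _ => Bool) Equiv.intEquivNat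
      obtain ⟨a, ha⟩ := fullShift_exists_returnTimes A m
      let τ : Cantor ≃ₜ Cantor := (g.symm.trans fullShift).trans g
      refine ⟨τ, a.comp (g.symm : C(Cantor, ℤ → Bool)), ?_⟩
      rwa [returnTimes_conj (T := fullShift) g.symm fun x => by simp [τ]])
  exact ⟨a.comp (g : C(Cantor, Cantor)), by rwa [returnTimes_conj g hg]⟩

/-! ### Countably many clopen sets, and diagonalization -/

instance cantor_clopen_countable : Countable C(Cantor, Bool) := by
  have : Countable (TopologicalSpace.Clopens Cantor) :=
    TopologicalSpace.Clopens.countable_iff_secondCountable.2 inferInstance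
  let f : C(Cantor, Bool) → TopologicalSpace.Clopens Cantor := fun a =>
    ⟨a ⁻¹' {true}, (isClopen_discrete {true}).preimage a.continuous⟩
  refine Function.Injective.countable (f := f) fun a b h => ContinuousMap.ext fun x => ?_
  have hx : x ∈ f a ↔ x ∈ f b := by rw [h]
  exact Bool.eq_iff_iff.2 hx

theorem exists_not_returnTimes (S : Cantor ≃ₜ Cantor) : ∃ A : Set ℕ, ∀ a, returnTimes S a ≠ A := by
  by_contra! h
  have : Nonempty C(Cantor, Bool) := ⟨ContinuousMap.const _ true⟩
  obtain ⟨f, hf⟩ := exists_surjective_nat C(Cantor, Bool)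
  exact Function.cantor_surjective (fun n => returnTimes S (f n))
    (fun A => (h A).elim fun a ha => (hf a).imp fun n hn => by simp only [hn, ha])

/-! ### Separable models realizing prescribed return times -/

/-- If every initial segment of `A` is the initial segment of a set of return times of `S`, then
`A` is a set of return times of a homeomorphism of the Cantor set with the same types as `S`. -/
theorem exists_homeo_pattern_eq_returnTimes (S : Cantor ≃ₜ Cantor) (A : Set ℕ)
    (hA : ∀ m, ∃ a, ∀ k < m, (k ∈ returnTimes S a ↔ k ∈ A)) :
    ∃ τ : Cantor ≃ₜ Cantor,
      (∀ m d, pattern S m d (fun _ => ()) = pattern τ m d (fun _ => ())) ∧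
      ∃ a, returnTimes τ a = A := by
  classical
  choose a ha using hA
  -- Names for the operations: Boolean functions, Skolem functions for each type, and composition
  -- with `S` or its inverse. They are countably many because the sets of types are finite.
  let ι := (Σ k : ℕ, ((Fin k → Bool) → Bool)) ⊕
    ((Σ (k m d : ℕ), Pattern m d ((Fin k → Bool) × Bool)) ⊕ Bool)
  let ar : ι → ℕ := Sum.elim (fun p => p.1) (Sum.elim (fun p => p.1) fun _ => 1)
  let op : ∀ i : ι, (Fin (ar i) → ℕ → C(Cantor, Bool)) → ℕ → C(Cantor, Bool) := fun i =>
    match i with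
    | .inl ⟨_, f⟩ => fun v n => ⟨fun x => f fun i => v i n x,
        (continuous_of_discreteTopology (f := f)).comp (continuous_pi fun i => (v i n).continuous)⟩
    | .inr (.inl ⟨_, m, d, t⟩) => fun v n =>
        if h : ∃ Q : C(Cantor, Bool), pattern S m d (fun x => (fun i => v i n x, Q x)) = t
        then h.choose else ContinuousMap.const _ true
    | .inr (.inr true) => fun v n => (v (0 : Fin 1) n).comp (S : C(Cantor, Cantor))
    | .inr (.inr false) => fun v n => (v (0 : Fin 1) n).comp (S.symm : C(Cantor, Cantor))
  obtain ⟨J, hJc, haJ, hJ⟩ := exists_countable_closed_family ar op a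
  let e : J → ℕ → C(Cantor, Bool) := fun j => j.1
  let s : J ≃ J :=
    { toFun := fun j => ⟨fun n => (j.1 n).comp (S : C(Cantor, Cantor)),
        hJ (.inr (.inr true)) (fun _ => j.1) fun _ => j.2⟩
      invFun := fun j => ⟨fun n => (j.1 n).comp (S.symm : C(Cantor, Cantor)),
        hJ (.inr (.inr false)) (fun _ => j.1) fun _ => j.2⟩
      left_inv := fun j => Subtype.ext (funext fun n => ContinuousMap.ext fun x =>
        congrArg (j.1 n) (S.apply_symm_apply x))
      right_inv := fun j => Subtype.ext (funext fun n => ContinuousMap.ext fun x =>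
        congrArg (j.1 n) (S.symm_apply_apply x)) }
  have hs : ∀ j n x, e (s j) n x = e j n (S x) := fun _ _ _ => rfl
  have hbool : ∀ (k : ℕ) (j : Fin k → J) (f : (Fin k → Bool) → Bool),
      ∃ b, ∀ n x, e b n x = f fun i => e (j i) n x := fun k j f =>
    ⟨⟨_, hJ (.inl ⟨k, f⟩) (fun i => (j i).1) fun i => (j i).2⟩, fun _ _ => rfl⟩
  have hwit : ∀ (k m d : ℕ) (j : Fin k → J) (t : Pattern m d ((Fin k → Bool) × Bool)),
      ∃ b, ∀ n, (∃ Q : C(Cantor, Bool),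
          pattern S m d (fun x => (fun i => e (j i) n x, Q x)) = t) →
        pattern S m d (fun x => (fun i => e (j i) n x, e b n x)) = t := fun k m d j t =>
    ⟨⟨_, hJ (.inr (.inl ⟨k, m, d, t⟩)) (fun i => (j i).1) fun i => (j i).2⟩, fun n hn => by
      have h : e ⟨_, hJ (.inr (.inl ⟨k, m, d, t⟩)) (fun i => (j i).1) fun i => (j i).2⟩ n =
        hn.choose := dif_pos hn
      rw [h]
      exact hn.choose_spec⟩
  let U : Ultrafilter ℕ := hyperfilter ℕ
  let T := limitHomeo U (e := fun j n x => e j n x) hs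
  have hlim : ∀ (m d : ℕ) {k : ℕ} (j : Fin k → J), ∀ᶠ n in (U : Filter ℕ),
      pattern S m d (fun x i => e (j i) n x) = pattern T m d (fun y i => y.1 (j i)) :=
    fun m d _ j => eventually_pattern_eq hs hbool hwit m d j
  obtain ⟨y₀, -⟩ := exists_mem_limitSpace (U := U) (e := fun j n x => e j n x) (F := ∅)
    (z := fun _ => true) (Eventually.of_forall fun n => ⟨fun _ => true, by simp⟩)
  have : Nonempty (limitSpace U fun j n x => e j n x) := ⟨y₀⟩
  have : Nonempty J := ⟨⟨a, haJ⟩⟩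
  have : Countable J := hJc
  obtain ⟨enum, henum⟩ := exists_surjective_nat J
  have hcoord : ∀ j : J, Continuous fun y : limitSpace U (fun j n x => e j n x) => y.1 j :=
    fun j => (continuous_apply j).comp continuous_subtype_val
  obtain ⟨g⟩ := nonempty_homeomorph_cantor (Y := limitSpace U fun j n x => e j n x)
    (fun n => ⟨fun y => y.1 (enum n), hcoord (enum n)⟩)
    (fun y y' h => Subtype.ext (funext fun j => by
      obtain ⟨n, rfl⟩ := henum j
      exact h n))
    (fun D hD => by
      obtain ⟨y, hy⟩ := hD
      obtain ⟨b, hb⟩ := exists_coordinate_eq hbool D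
      -- Atomlessness is visible at depth one with words of length one: `D` is matched with a
      -- nonempty clopen subset of the Cantor set, that set is split, and the split is answered in
      -- the limit.
      obtain ⟨n, hn⟩ := (hlim 1 1 fun _ : Fin 1 => b).exists
      obtain ⟨x, hx⟩ := (pattern_zero_eq_iff.1 (pattern_mono le_rfl zero_le_one hn)).2 y
      have hx0 : e b n x = y.1 b := congrFun (hx 0) 0
      obtain ⟨E, hE⟩ := cantor_exists_split (e b n) ⟨x, by rw [hx0, ← hb, hy]⟩
      obtain ⟨E', hEE'⟩ := (pattern_succ_eq_iff.1 hn).1 E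
      refine ⟨E', fun c => ?_⟩
      obtain ⟨x', hx', hc⟩ := hE c
      obtain ⟨y', hy'⟩ := (pattern_zero_eq_iff.1 hEE').1 x'
      have h0 := Prod.ext_iff.1 (hy' 0)
      refine ⟨y', ?_, ?_⟩
      · rw [hb, ← hx']
        exact (congrFun h0.1 0).symm
      · rw [← hc]
        exact h0.2.symm)
  let τ : Cantor ≃ₜ Cantor := (g.symm.trans T).trans g
  have hgT : ∀ y, g (T y) = τ (g y) := fun y => by simp [τ]
  refine ⟨τ, fun m d => ?_, ?_⟩
  · obtain ⟨n, hn⟩ := (hlim m d (Fin.elim0 : Fin 0 → J)).exists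
    have h₁ := pattern_comp hn fun _ => ()
    exact h₁.trans (pattern_conj g hgT fun _ => ())
  · refine ⟨⟨fun x => (g.symm x).1 ⟨a, haJ⟩, (hcoord ⟨a, haJ⟩).comp g.symm.continuous⟩, ?_⟩
    rw [← returnTimes_conj g hgT]
    ext k
    -- Nonprincipality is used here: `a n` agrees with `A` at `k` once `n` exceeds `k`.
    have hev : ∀ᶠ n in (U : Filter ℕ), (k ∈ returnTimes S (a n) ↔ k ∈ A) := by
      have : ∀ᶠ n in (U : Filter ℕ), k < n :=
        (Nat.hyperfilter_le_atTop : (hyperfilter ℕ : Filter ℕ) ≤ atTop) (eventually_gt_atTop k)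
      filter_upwards [this] with n hn using ha n k hn
    -- A word of length `k + 2` shows both positions `0` and `k + 1`.
    obtain ⟨n, hn, hk⟩ := ((hlim (k + 2) 0 fun _ : Fin 1 => (⟨a, haJ⟩ : J)).and hev).exists
    rw [← hk]
    rw [pattern_zero_eq_iff] at hn
    constructor
    · rintro ⟨y, h₁, h₂⟩
      obtain ⟨x, hx⟩ := hn.2 y
      have e₁ : a n x = y.1 ⟨a, haJ⟩ := congrFun (hx 0) 0
      have e₂ : a n (S^[k + 1] x) = (T^[k + 1] y).1 ⟨a, haJ⟩ := congrFun (hx (Fin.last _)) 0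
      refine ⟨x, ?_, ?_⟩
      · rw [e₁]; simpa using h₁
      · rw [e₂]; simpa using h₂
    · rintro ⟨x, h₁, h₂⟩
      obtain ⟨y, hy⟩ := hn.1 x
      have e₁ : a n x = y.1 ⟨a, haJ⟩ := congrFun (hy 0) 0
      have e₂ : a n (S^[k + 1] x) = (T^[k + 1] y).1 ⟨a, haJ⟩ := congrFun (hy (Fin.last _)) 0
      refine ⟨y, ?_, ?_⟩
      · rw [e₁] at h₁; simpa using h₁
      · rw [e₂] at h₂; simpa using h₂

/-! ### The type of a projection with prescribed return times -/

/-- The iterated application of the automorphism to a term. -/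
def Term.autIter {n : ℕ} (t : Term n) (k : ℕ) : Term n := Term.aut^[k] t

/-- The term `x * α^(k + 1)(x)`. -/
def returnTerm (k : ℕ) : Term 1 := .mul (.var 0) (Term.autIter (.var 0) (k + 1))

/-- The type of an idempotent whose set of return times is `A`. -/
def returnType (A : Set ℕ) : Set (Formula 1) :=
  {.norm (.add (.mul (.var 0) (.var 0)) (.smul (-1) (.var 0)))} ∪
    ((fun k => .conn (k := 1) ⟨fun r => r 0 - 1, by fun_prop⟩ fun _ => .norm (returnTerm k)) '' A ∪
      (fun k => .norm (returnTerm k)) '' Aᶜ)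

/-- An idempotent function takes only the values `0` and `1`, so it is the indicator of a clopen
set; `returnType` therefore needs no self-adjointness clause. -/
theorem exists_indicator_of_idempotent {X : Type*} [TopologicalSpace X] {f : C(X, ℂ)} (hf : ∀ x, f x * f x = f x) :
    ∃ a : C(X, Bool), ∀ x, f x = if a x then 1 else 0 := by
  classical
  have h01 : ∀ x, f x = 0 ∨ f x = 1 := fun x => by
    rcases eq_or_ne (f x) 0 with h | h
    · exact Or.inl h
    · exact Or.inr (mul_left_cancel₀ h ((hf x).trans (mul_one _).symm))
  have hclopen : IsClopen (f ⁻¹' {1}) := by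
    refine ⟨isClosed_singleton.preimage f.continuous, ?_⟩
    have : f ⁻¹' {1} = (f ⁻¹' {0})ᶜ := by
      ext x
      rcases h01 x with h | h <;> simp [h]
    rw [this]
    exact (isClosed_singleton.preimage f.continuous).isOpen_compl
  refine ⟨⟨(f ⁻¹' {1}).boolIndicator, (continuous_boolIndicator_iff_isClopen _).2 hclopen⟩,
    fun x => ?_⟩
  rcases h01 x with h | h <;> simp [boolIndicator, h]

section

variable {X : Type*} [TopologicalSpace X] [CompactSpace X] (S : X ≃ₜ X)

theorem Term.autIter_eval_apply {n : ℕ} (t : Term n) (k : ℕ) (v : Fin n → C(X, ℂ)) (x : X) :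
    (t.autIter k).eval (inducedAut S) v x = t.eval (inducedAut S) v (S^[k] x) := by
  induction k generalizing x with
  | zero => rfl
  | succ k ih =>
    rw [autIter, Function.iterate_succ_apply', Function.iterate_succ_apply]
    exact ih (S x)

/-- The term is the indicator of the points of `a` that return at time `k + 1`, so its norm only
tests whether such a point exists. -/
theorem norm_returnTerm {f : C(X, ℂ)} {a : C(X, Bool)} (hfa : ∀ x, f x = if a x then 1 else 0)
    (k : ℕ) [Decidable (k ∈ returnTimes S a)] :
    ‖(returnTerm k).eval (inducedAut S) fun _ => f‖ = if k ∈ returnTimes S a then 1 else 0 := by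
  have happ : ∀ x, (returnTerm k).eval (inducedAut S) (fun _ => f) x =
      if a x = true ∧ a (S^[k + 1] x) = true then 1 else 0 := by
    intro x
    change f x * (Term.autIter (.var 0) (k + 1)).eval (inducedAut S) (fun _ => f) x = _
    rw [Term.autIter_eval_apply]
    change f x * f (S^[k + 1] x) = _
    rw [hfa, hfa]
    by_cases h₁ : a x = true <;> by_cases h₂ : a (S^[k + 1] x) = true <;> simp [h₁, h₂, -Function.iterate_succ]
  split_ifs with h
  · obtain ⟨x, hx⟩ := h
    refine le_antisymm ((ContinuousMap.norm_le _ zero_le_one).2 fun x => ?_) ?_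
    · rw [happ]
      split_ifs <;> simp
    · have := ((returnTerm k).eval (inducedAut S) fun _ => f).norm_coe_le_norm x
      rwa [happ, if_pos hx, norm_one] at this
  · rw [norm_eq_zero]
    ext x
    rw [happ, if_neg fun hx => h ⟨x, hx⟩]
    rfl

theorem realizes_returnType_iff (A : Set ℕ) :
    Realizes (inducedAut S) (returnType A) ↔ ∃ a, returnTimes S a = A := by
  classical
  constructor
  · rintro ⟨v, hv⟩
    obtain ⟨f, rfl⟩ : ∃ f : C(X, ℂ), v = fun _ => f :=
      ⟨v 0, funext fun i => congrArg v (Subsingleton.elim _ _)⟩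
    have hidem : ‖f * f + (-1 : ℂ) • f‖ = 0 := hv _ (Or.inl rfl)
    rw [norm_eq_zero] at hidem
    obtain ⟨a, ha⟩ := exists_indicator_of_idempotent (f := f) fun x => by
      have := DFunLike.congr_fun hidem x
      simp only [ContinuousMap.add_apply, ContinuousMap.mul_apply, ContinuousMap.smul_apply,
        smul_eq_mul, ContinuousMap.zero_apply] at this
      linear_combination this
    refine ⟨a, Set.ext fun k => ⟨fun hk => ?_, fun hk => ?_⟩⟩
    · by_contra hkA
      have h0 : ‖(returnTerm k).eval (inducedAut S) fun _ => f‖ = 0 :=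
        hv _ (Or.inr (Or.inr ⟨k, hkA, rfl⟩))
      rw [norm_returnTerm S ha, if_pos hk] at h0
      exact one_ne_zero h0
    · by_contra hka
      have h1 : ‖(returnTerm k).eval (inducedAut S) fun _ => f‖ - 1 = 0 :=
        hv _ (Or.inr (Or.inl ⟨k, hk, rfl⟩))
      rw [norm_returnTerm S ha, if_neg hka] at h1
      norm_num at h1
  · rintro ⟨a, rfl⟩
    let f : C(X, ℂ) := ⟨fun x => if a x then 1 else 0,
      (continuous_of_discreteTopology (f := fun b : Bool => if b then (1 : ℂ) else 0)).comp
        a.continuous⟩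
    have hfa : ∀ x, f x = if a x then 1 else 0 := fun _ => rfl
    refine ⟨fun _ => f, ?_⟩
    rintro φ (rfl | ⟨k, hk, rfl⟩ | ⟨k, hk, rfl⟩)
    · change ‖f * f + (-1 : ℂ) • f‖ = 0
      rw [norm_eq_zero]
      ext x
      simp only [ContinuousMap.add_apply, ContinuousMap.mul_apply, ContinuousMap.smul_apply,
        hfa, smul_eq_mul, ContinuousMap.zero_apply]
      split_ifs <;> simp
    · change ‖(returnTerm k).eval (inducedAut S) fun _ => f‖ - 1 = 0
      rw [norm_returnTerm S hfa, if_pos hk, sub_self]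
    · change ‖(returnTerm k).eval (inducedAut S) fun _ => f‖ = 0
      rw [norm_returnTerm S hfa, if_neg hk]

end

/-! ### Invariance under isomorphism -/

section Isomorphism

variable {A B : Type*} [CStarAlgebra A] [CStarAlgebra B] {α : A ≃⋆ₐ[ℂ] A} {β : B ≃⋆ₐ[ℂ] B}

theorem Term.eval_map (Φ : A ≃⋆ₐ[ℂ] B) (hΦ : ∀ a, Φ (α a) = β (Φ a)) {n : ℕ} (t : Term n)
    (v : Fin n → A) : t.eval β (fun i => Φ (v i)) = Φ (t.eval α v) := by
  induction t with
  | var i => rfl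
  | one => exact (map_one Φ).symm
  | add s t hs ht => simp only [eval, hs, ht, map_add]
  | mul s t hs ht => simp only [eval, hs, ht, map_mul]
  | smul c t ht => simp only [eval, ht, map_smul]
  | star t ht => simp only [eval, ht, map_star]
  | aut t ht => simp only [eval, ht, hΦ]

/-- An isomorphism is isometric, so it restricts to bijections of the closed balls and merely
reindexes the quantifiers. -/
theorem Formula.eval_map (Φ : A ≃⋆ₐ[ℂ] B) (hΦ : ∀ a, Φ (α a) = β (Φ a)) {n : ℕ} (φ : Formula n)
    (v : Fin n → A) : φ.eval β (fun i => Φ (v i)) = φ.eval α v := by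
  have hnorm : ∀ a, ‖Φ a‖ = ‖a‖ := fun a => NonUnitalStarAlgHom.norm_map Φ Φ.injective a
  let ball : ∀ r : ℕ, Metric.closedBall (0 : A) (r : ℝ) ≃ Metric.closedBall (0 : B) (r : ℝ) :=
    fun r => Φ.toEquiv.subtypeEquiv fun a => by
      rw [mem_closedBall_zero_iff, mem_closedBall_zero_iff]
      exact iff_of_eq (congrArg (· ≤ (r : ℝ)) (hnorm a).symm)
  have hsnoc : ∀ {n r : ℕ} (v : Fin n → A) (x : Metric.closedBall (0 : A) (r : ℝ)),
      (Fin.snoc (fun i => Φ (v i)) (ball r x : B) : Fin (n + 1) → B) =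
        fun i => Φ ((Fin.snoc v (x : A) : Fin (n + 1) → A) i) := by
    intro n r v x
    funext i
    refine Fin.lastCases ?_ (fun j => ?_) i
    · simp only [Fin.snoc_last]; rfl
    · simp only [Fin.snoc_castSucc]
  induction φ with
  | norm t => simp only [eval, t.eval_map Φ hΦ, hnorm]
  | conn u φ ih => simp only [eval, ih]
  | sup r φ ih =>
    simp only [eval]
    rw [← (ball r).iSup_comp]
    simp only [hsnoc, ih]
  | inf r φ ih =>
    simp only [eval]
    rw [← (ball r).iInf_comp]
    simp only [hsnoc, ih]

theorem Isomorphic.realizes (h : Isomorphic α β) {n : ℕ} {p : Set (Formula n)}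
    (hp : Realizes α p) : Realizes β p := by
  obtain ⟨Φ, hΦ⟩ := h
  obtain ⟨v, hv⟩ := hp
  exact ⟨fun i => Φ (v i), fun φ hφ => (φ.eval_map Φ hΦ v).trans (hv φ hφ)⟩

end Isomorphism

theorem TopConj.returnTimes {X Y : Type*} [TopologicalSpace X] [TopologicalSpace Y] {S : X ≃ₜ X}
    {T : Y ≃ₜ Y} (h : TopConj S T) {A : Set ℕ} (hA : ∃ a, returnTimes T a = A) :
    ∃ a, returnTimes S a = A := by
  obtain ⟨g, hg⟩ := h
  obtain ⟨a, ha⟩ := hA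
  exact ⟨a.comp (g : C(X, Y)), (returnTimes_conj g hg a).trans ha⟩

end CantorDynamics

end

/-! ### The main theorem -/

theorem corollary3p6 (σ : CantorDynamics.Cantor ≃ₜ CantorDynamics.Cantor)
    (hσ : CantorDynamics.IsGeneric σ) :
    ¬ CantorDynamics.SeparablyCategorical
        (CantorDynamics.theory (CantorDynamics.inducedAut σ)) ∧
    ∃ τ : CantorDynamics.Cantor ≃ₜ CantorDynamics.Cantor,
      CantorDynamics.Models (CantorDynamics.inducedAut τ)
        (CantorDynamics.theory (CantorDynamics.inducedAut σ)) ∧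
      (∃ (n : ℕ) (p : Set (CantorDynamics.Formula n)),
        ¬ CantorDynamics.Realizes (CantorDynamics.inducedAut σ) p ∧
        CantorDynamics.Realizes (CantorDynamics.inducedAut τ) p) ∧
      ¬ CantorDynamics.TopConj σ τ := by
  obtain ⟨A, hA⟩ := CantorDynamics.exists_not_returnTimes σ
  obtain ⟨τ, hτ, hτA⟩ := CantorDynamics.exists_homeo_pattern_eq_returnTimes σ A fun m =>
    hσ.exists_returnTimes A m
  have hmod := CantorDynamics.models_theory_of_pattern_eq σ τ hτ
  have hσA : ¬ ∃ a, CantorDynamics.returnTimes σ a = A := fun ⟨a, ha⟩ => hA a ha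
  have homit : ¬ CantorDynamics.Realizes (CantorDynamics.inducedAut σ)
      (CantorDynamics.returnType A) := fun h =>
    hσA ((CantorDynamics.realizes_returnType_iff σ A).1 h)
  have hreal := (CantorDynamics.realizes_returnType_iff τ A).2 hτA
  refine ⟨fun hcat => ?_, τ, hmod, ⟨1, _, homit, hreal⟩, fun hconj => hσA (hconj.returnTimes hτA)⟩
  -- Categoricity would identify the two models and carry the realization of the type from `τ` to
  -- `σ`.
  exact homit ((hcat _ _ (CantorDynamics.inducedAut τ) (CantorDynamics.inducedAut σ) hmod
    fun φ hφ => hφ).realizes hreal)
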